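/- **Setting.** Let $M$ be a manifold with a smooth volume measure and a fixed splitting $M\cong\mathbb R\times N$ with time function $t$ (a globally hyperbolic space-time). A set is *spatially compact* if it meets every slab $\{t'\le t\le t''\}$ in a compact set. $\Gamma_+(X)$ (resp. $\Gamma_-(X)$) denotes the smooth or distributional sections of a vector bundle $X\to M$ with spatially compact support contained in $\{t\ge t_0\}$ (resp. $\{t\le t_0\}$) for some $t_0$; $\Gamma_0$ means compact support. Condensed notation is used: contraction of indices includes integration over $M$. Fields $\varphi$ are the smooth sections of a vector bundle $W\to M$ with values in an open set $U\subset W$; so vector fields on the space $\mathcal M$ of fields take values in $\Gamma(W)$ and 1-forms in $\Gamma(W^*)$. Let $T_a[\varphi]=0$ be local field equations with values in $\Gamma(E)$, $\Sigma$ the set of solutions, $J_{ai}=T_{a,i}$ the Jacobi operator (a linear differential operator), $\approx$ equality on $\Sigma$. Let $R$ be gauge symmetry generators, $J\circ R\approx0$, and $L$ generators of gauge identities, $L^a_AT_a\equiv0$, both differential operators; assume that the on-shell complexes $$\Gamma_\pm(F)\xrightarrow{R}\Gamma_\pm(W)\xrightarrow{J}\Gamma_\pm(E)\xrightarrow{L}\Gamma_\pm(G),\qquad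 \Gamma_\pm(G^*)\xrightarrow{L^*}\Gamma_\pm(E^*)\xrightarrow{J^*}\Gamma_\pm(W^*)\xrightarrow{R^*}\Gamma_\pm(F^*)$$ are exact at their middle terms, for smooth and for distributional sections. Let $V=\{V^i_a\}$ be a Lagrange anchor: differential operators $V[\varphi]:\Gamma(E^*)\to\Gamma(W)$ with $J\circ V\approx V^*\circ J^*$. A *physical observable* is a differentiable functional $A$ of the fields with compactly supported (possibly distributional) derivative $\delta A=A_{,i}$ and $A_{,i}R^i_\alpha\approx0$; it is *regular* if $A_{,i}$ is smooth. An advanced/retarded *fluctuation* of $A$ is a vector field $V_A^\pm\in\Gamma_\pm(W)$ with $V_A^\pm T_a\approx V_aA$; an advanced/retarded *repercussion* of $A$ is $A_\pm\in\Gamma_\pm(E^*)$ with $\delta A\approx A_\pm^a\,\delta T_a$. Put $\{A,B\}^\pm=V_A^\pm B-V_B^\pm A$. Let $A,B$ be observables, $B$ regular; the repercussions and fluctuations of $B$ are taken smooth, those of $A$ may be distributional (so that all contractions are defined). **Claim.** 1. $A$ and $B$ have repercussions $A_\pm$, $B_\pm$ ($B_\pm$ smooth), unique on shell modulo $L^*\Gamma_\pm(G^*)$;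 for any of them $A_\pm^aV_a$ and $B_\pm^aV_a$ are fluctuations caused by $A$ and $B$. 2. (Reciprocity.) For all fluctuations, $V_A^-B\approx V_B^+A$ and $V_B^-A\approx V_A^+B$. 3. Consequently $\{A,B\}^+\approx\{B,A\}^-$, equivalently $\{A,B\}^+\approx-\{A,B\}^-$: the advanced and retarded brackets agree up to sign. Moreover $\{A,B\}^\pm\approx\pm\tilde V_AB$ with $\tilde V_A=(A_+-A_-)^aV_a$, and likewise $\{B,A\}^\pm\approx\pm\tilde V_BA$. 4. Suppose that $E=W^*$ and that $T_i=S_{,i}$ for an action functional $S$ with local density. Then $V=1$ is a Lagrange anchor. Suppose also that on shell there are advanced and retarded Green functions $G^{\pm ij}$ (operators from $\Gamma_0(W^*)$ to smooth sections of $W$ with spatially compact support) with $G^{\pm in}S_{,nj}=S_{,jn}G^{\pm ni}=\delta^i_j$, where $G^{+ij}=0$ if the time of $i$ is later than that of $j$ and $G^{-ij}=0$ if it is earlier. Then, for $V=1$ and any functionals $A,B$ as above (here gauge invariance and exactness need not be assumed), $V_A^{\pm j}\approx A_{,i}G^{\pm ij}$, the vector fields $G^{\mp ij}B_{,j}$ are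 fluctuations $V_B^\pm$, and the brackets are Peierls' brackets $$\{A,B\}^\pm\approx\pm A_{,i}\tilde G^{ij}B_{,j},\qquad \tilde G=G^+-G^-.$$ -/

import Mathlib

open Bundle Manifold Set MeasureTheory
open scoped ContDiff Topology

universe u v w

noncomputable section

/-! ### Smooth vector bundles over the space-time and their sections -/

section Bundles

set_option linter.checkUnivs false in
/-- A smooth real vector bundle of finite rank over the `d`-dimensional manifold `M`: Mathlib's
unbundled notion, with fibres `V x` and model fibre `F`, put into one object. -/
structure VBundle (d : ℕ) (M : Type u) [TopologicalSpace M]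
    [ChartedSpace (EuclideanSpace ℝ (Fin d)) M] where
  F : Type v
  V : M → Type w
  [normF : NormedAddCommGroup F]
  [spaceF : NormedSpace ℝ F]
  [finF : FiniteDimensional ℝ F]
  [addV : ∀ x, AddCommGroup (V x)]
  [modV : ∀ x, Module ℝ (V x)]
  [topV : ∀ x, TopologicalSpace (V x)]
  [topTotal : TopologicalSpace (TotalSpace F V)]
  [fiber : FiberBundle F V]
  [vector : VectorBundle ℝ F V]
  [smooth : ContMDiffVectorBundle ∞ F V (𝓡 d)]

attribute [instance] VBundle.normF VBundle.spaceF VBundle.finF VBundle.addV VBundle.modV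
  VBundle.topV VBundle.topTotal VBundle.fiber VBundle.vector VBundle.smooth

variable {d : ℕ} {M : Type u} [TopologicalSpace M] [ChartedSpace (EuclideanSpace ℝ (Fin d)) M]

/-- The dual bundle `X*`. -/
def VBundle.dual (X : VBundle.{u, v, w} d M) : VBundle.{u, v, w} d M where
  F := X.F →L[ℝ] ℝ
  V := fun x => X.V x →L[ℝ] Bundle.Trivial M ℝ x

/-- The space `Γ(X)` of smooth sections. -/
abbrev VBundle.Γ (X : VBundle.{u, v, w} d M) : Type _ := Cₛ^∞⟮𝓡 d; X.F, X.V⟯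

/-- The ring `C^∞(M)`. -/
abbrev SmoothFun (d : ℕ) (M : Type u) [TopologicalSpace M]
    [ChartedSpace (EuclideanSpace ℝ (Fin d)) M] : Type _ := C^∞⟮𝓡 d, M; 𝓘(ℝ, ℝ), ℝ⟯

variable {X Y Z : VBundle.{u, v, w} d M}

instance : SMul (SmoothFun d M) X.Γ :=
  ⟨fun f s => ⟨fun x => f x • s x, f.contMDiff.smul_section s.contMDiff⟩⟩

theorem VBundle.smul_apply (f : SmoothFun d M) (s : X.Γ) (x : M) : (f • s) x = f x • s x := rfl

instance : Module (SmoothFun d M) X.Γ where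
  one_smul s := by ext x; simp [VBundle.smul_apply]
  mul_smul f g s := by ext x; simp [VBundle.smul_apply, mul_smul]
  smul_zero f := by ext x; simp [VBundle.smul_apply]
  smul_add f s t := by ext x; simp [VBundle.smul_apply]
  add_smul f g s := by ext x; simp [VBundle.smul_apply, add_smul]
  zero_smul s := by ext x; simp [VBundle.smul_apply]

instance : SMulCommClass (SmoothFun d M) ℝ X.Γ :=
  ⟨fun f r s => by ext x; simp [VBundle.smul_apply, smul_comm (f x) r (s x)]⟩

/-- The fibrewise contraction of a section of `X*` with a section of `X`. -/
def pairing (α : X.dual.Γ) (s : X.Γ) (x : M) : ℝ :=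
  (show X.V x →L[ℝ] ℝ from α x) (s x)

theorem pairing_contMDiff (α : X.dual.Γ) (s : X.Γ) :
    ContMDiff (𝓡 d) 𝓘(ℝ, ℝ) ∞ (pairing α s) := by
  have := ContMDiff.clm_bundle_apply (F₁ := X.F) (F₂ := ℝ) (E₁ := X.V)
    (E₂ := Bundle.Trivial M ℝ) (ϕ := fun x => α x) α.contMDiff s.contMDiff
  intro x
  have h := this x
  simp only [contMDiffAt_totalSpace] at h
  exact h.2

/-- The support of a section. -/
def VBundle.supp (s : X.Γ) : Set M := closure {x | s x ≠ 0}

/-- The space `Γ₀(X)` of smooth sections with compact support. -/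
def VBundle.compactSections (X : VBundle.{u, v, w} d M) : Submodule ℝ X.Γ where
  carrier := {s | IsCompact (VBundle.supp s)}
  zero_mem' := by simp [VBundle.supp]
  add_mem' := by
    intro a b ha hb
    refine (IsCompact.union ha hb).of_isClosed_subset isClosed_closure ?_
    rw [VBundle.supp, VBundle.supp, VBundle.supp, ← closure_union]
    refine closure_mono fun x hx => ?_
    by_contra h
    simp only [mem_union, mem_ofPred_eq, not_or, not_not] at h
    exact hx (by simp [h.1, h.2])
  smul_mem' := by
    intro c a ha
    refine IsCompact.of_isClosed_subset ha isClosed_closure (closure_mono fun x hx => ?_)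
    intro h
    exact hx (by simp [h])

notation "Γ₀" => VBundle.compactSections

end Bundles

/-! ### Linear differential operators -/

section DifferentialOperators

/-- The commutator `[D, a]` of a linear map with the multiplication by `a`. -/
def mulCommutator {A P Q : Type*} [CommRing A] [Algebra ℝ A] [AddCommGroup P] [Module ℝ P]
    [Module A P] [SMulCommClass A ℝ P] [AddCommGroup Q] [Module ℝ Q] [Module A Q]
    [SMulCommClass A ℝ Q] (D : P →ₗ[ℝ] Q) (a : A) : P →ₗ[ℝ] Q :=
  D ∘ₗ DistribSMul.toLinearMap ℝ P a - DistribSMul.toLinearMap ℝ Q a ∘ₗ D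

/-- Linear differential operators of order at most `k` between modules over `A`, in the sense of
Grothendieck: all `(k+1)`-fold commutators with multiplications vanish. For `A = C^∞(M)` and
modules of sections of vector bundles these are the usual linear differential operators. -/
def IsDiffOpOfOrder (A : Type*) {P Q : Type*} [CommRing A] [Algebra ℝ A] [AddCommGroup P]
    [Module ℝ P] [Module A P] [SMulCommClass A ℝ P] [AddCommGroup Q] [Module ℝ Q] [Module A Q]
    [SMulCommClass A ℝ Q] : ℕ → (P →ₗ[ℝ] Q) → Prop
  | 0, D => ∀ a : A, mulCommutator D a = 0
  | k + 1, D => ∀ a : A, IsDiffOpOfOrder A k (mulCommutator D a)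

variable {d : ℕ} {M : Type u} [TopologicalSpace M] [ChartedSpace (EuclideanSpace ℝ (Fin d)) M]

/-- A linear differential operator `Γ(X) → Γ(Y)`. -/
structure DiffOp (X Y : VBundle.{u, v, w} d M) where
  toLinearMap : X.Γ →ₗ[ℝ] Y.Γ
  isDiffOp : ∃ k, IsDiffOpOfOrder (SmoothFun d M) k toLinearMap

instance (X Y : VBundle.{u, v, w} d M) : CoeFun (DiffOp X Y) fun _ => X.Γ → Y.Γ :=
  ⟨fun P => P.toLinearMap⟩

variable {X Y : VBundle.{u, v, w} d M}

/-- The identity operator. -/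
def DiffOp.id (X : VBundle.{u, v, w} d M) : DiffOp X X :=
  ⟨LinearMap.id, 0, fun a => by ext s; simp [mulCommutator]⟩

theorem exists_cutoff [T2Space M] [IsManifold (𝓡 d) ∞ M] (s : X.Γ) (x : M)
    (hs : ∀ᶠ y in 𝓝 x, s y = 0) : ∃ g : SmoothFun d M, g x = 1 ∧ g • s = 0 := by
  obtain ⟨f, -, hf⟩ := (SmoothBumpFunction.nhds_basis_tsupport (I := 𝓡 d) x).mem_iff.1 hs
  refine ⟨⟨f, f.contMDiff⟩, f.eq_one, ?_⟩
  ext y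
  change f y • s y = 0
  by_cases hy : y ∈ tsupport f
  · rw [show s y = 0 from hf hy, smul_zero]
  · rw [image_eq_zero_of_notMem_tsupport hy, zero_smul]

theorem IsDiffOpOfOrder.apply_eq_zero [T2Space M] [IsManifold (𝓡 d) ∞ M] (k : ℕ)
    (D : X.Γ →ₗ[ℝ] Y.Γ) (hD : IsDiffOpOfOrder (SmoothFun d M) k D) (s : X.Γ) (x : M)
    (hs : ∀ᶠ y in 𝓝 x, s y = 0) : D s x = 0 := by
  obtain ⟨g, hg1, hg0⟩ := exists_cutoff s x hs
  have key : ∀ D : X.Γ →ₗ[ℝ] Y.Γ, (mulCommutator D g s) x = 0 → D s x = 0 := by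
    intro D h
    have h2 : (D (g • s) - g • D s) x = 0 := h
    rw [hg0, map_zero, zero_sub] at h2
    have h3 : -(g x • D s x) = 0 := h2
    rwa [hg1, one_smul, neg_eq_zero] at h3
  induction k generalizing D with
  | zero => exact key D (by rw [hD g]; rfl)
  | succ k ih => exact key D (ih _ (hD g))

variable [T2Space M] [IsManifold (𝓡 d) ∞ M]

/-- Differential operators do not increase supports. -/
theorem DiffOp.supp_subset (P : DiffOp X Y) (s : X.Γ) :
    VBundle.supp (P s) ⊆ VBundle.supp s := by
  obtain ⟨k, hk⟩ := P.isDiffOp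
  refine closure_minimal (fun x hx => ?_) isClosed_closure
  by_contra h
  refine hx (hk.apply_eq_zero k _ s x ?_)
  filter_upwards [isClosed_closure.isOpen_compl.mem_nhds h] with y hy
  by_contra h'
  exact hy (subset_closure h')

/-- The restriction of a differential operator to compactly supported sections. -/
def DiffOp.onCompact (P : DiffOp X Y) : Γ₀ X →ₗ[ℝ] Γ₀ Y :=
  P.toLinearMap.restrict fun s hs =>
    IsCompact.of_isClosed_subset hs isClosed_closure (P.supp_subset s)

end DifferentialOperators

/-! ### Supports, distributional sections -/

section Distributions

variable {d : ℕ} {M : Type u} [TopologicalSpace M] [ChartedSpace (EuclideanSpace ℝ (Fin d)) M]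

/-- The label `±` distinguishing advanced (`+`) from retarded (`-`) objects. -/
inductive Dir
  | plus
  | minus

/-- The opposite label. -/
def Dir.opp : Dir → Dir
  | .plus => .minus
  | .minus => .plus

/-- The sign `±1`. -/
def Dir.sign : Dir → ℝ
  | .plus => 1
  | .minus => -1

/-- `K` meets each slab `{t' ≤ time ≤ t}` in a compact set. -/
def SpatiallyCompact (time : M → ℝ) (K : Set M) : Prop :=
  ∀ t' t : ℝ, IsCompact (K ∩ {x | t' ≤ time x ∧ time x ≤ t})

/-- Supports of the elements of `Γ_±`: spatially compact and contained in
`M_t⁺ = {time ≥ t}`, respectively `M_t⁻ = {time ≤ t}`, for some `t`. -/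
def CausalSupport (time : M → ℝ) : Dir → Set M → Prop
  | .plus, K => SpatiallyCompact time K ∧ ∃ t, ∀ x ∈ K, t ≤ time x
  | .minus, K => SpatiallyCompact time K ∧ ∃ t, ∀ x ∈ K, time x ≤ t

/-- Linear functionals on the test sections `Γ₀(Y)`. The continuous ones (see
`Distr.IsContinuous`) are the distributional sections of `Y*`; distributional sections of `X`
are the continuous elements of `Distr X.dual`. -/
abbrev Distr (Y : VBundle.{u, v, w} d M) : Type _ := Γ₀ Y →ₗ[ℝ] ℝ

variable {X Y Z : VBundle.{u, v, w} d M}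

/-- `p` is bounded on `K` by `B`, for each scalar differential operator in the list `D`. -/
def BoundedOn (D : List (Y.Γ →ₗ[ℝ] SmoothFun d M)) (K : Set M) (s : Y.Γ) (B : ℝ) : Prop :=
  ∀ P ∈ D, ∀ x ∈ K, |P s x| ≤ B

/-- Continuity of a distributional section: on test sections with support in a given compact `K`
it is bounded by finitely many derivatives. -/
def Distr.IsContinuous (q : Distr Y) : Prop :=
  ∀ K : Set M, IsCompact K → ∃ (C : ℝ) (D : List (Y.Γ →ₗ[ℝ] SmoothFun d M)),
    (∀ P ∈ D, ∃ k, IsDiffOpOfOrder (SmoothFun d M) k P) ∧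
    ∀ (s : Γ₀ Y) (B : ℝ), VBundle.supp (s : Y.Γ) ⊆ K → 0 ≤ B → BoundedOn D K s B →
      |q s| ≤ C * B

/-- The support of a distributional section. -/
def Distr.supp (q : Distr Y) : Set M :=
  {x | ∀ O ∈ 𝓝 x, ∃ s : Γ₀ Y, VBundle.supp (s : Y.Γ) ⊆ O ∧ q s ≠ 0}

/-- `q` is a distributional section with advanced/retarded support. -/
def Distr.IsCausal (time : M → ℝ) (σ : Dir) (q : Distr Y) : Prop :=
  q.IsContinuous ∧ CausalSupport time σ q.supp

/-- A compactly supported distributional section of `Y*`, as a functional on all of `Γ(Y)`. -/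
def IsCompactDistr (a : Y.Γ →ₗ[ℝ] ℝ) : Prop :=
  ∃ (K : Set M) (C : ℝ) (D : List (Y.Γ →ₗ[ℝ] SmoothFun d M)), IsCompact K ∧
    (∀ P ∈ D, ∃ k, IsDiffOpOfOrder (SmoothFun d M) k P) ∧
    ∀ (s : Y.Γ) (B : ℝ), 0 ≤ B → BoundedOn D K s B → |a s| ≤ C * B

/-- Exactness, at the middle term, of a pair of consecutive differential operators
`Γ(X) → Γ(Y) → Γ(Z)` in the category of sections with `σ`-support: exactness of
`Γ_σ(X) → Γ_σ(Y) → Γ_σ(Z)` for smooth sections, and exactness of the transposed sequence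
`Γ_σ(Z*) → Γ_σ(Y*) → Γ_σ(X*)` for distributional sections. -/
def ExactPair [T2Space M] [IsManifold (𝓡 d) ∞ M] (time : M → ℝ) (σ : Dir) (b : DiffOp X Y)
    (a : DiffOp Y Z) : Prop :=
  (∀ y : Y.Γ, CausalSupport time σ (VBundle.supp y) →
    (a y = 0 ↔ ∃ x : X.Γ, CausalSupport time σ (VBundle.supp x) ∧ b x = y)) ∧
  (∀ q : Distr Y, q.IsCausal time σ →
    (q ∘ₗ b.onCompact = 0 ↔ ∃ e : Distr Z, e.IsCausal time σ ∧ e ∘ₗ a.onCompact = q))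

variable [MeasurableSpace M]

/-- The measure of a smooth volume form: in each chart it has a smooth positive density. -/
def IsSmoothVolume (d : ℕ) {M : Type u} [TopologicalSpace M]
    [ChartedSpace (EuclideanSpace ℝ (Fin d)) M] [MeasurableSpace M] (μ : Measure M) : Prop :=
  ∀ x : M, ∃ ρ : EuclideanSpace ℝ (Fin d) → ℝ,
    ContDiffOn ℝ ∞ ρ (chartAt (EuclideanSpace ℝ (Fin d)) x).target ∧
    (∀ y ∈ (chartAt (EuclideanSpace ℝ (Fin d)) x).target, 0 < ρ y) ∧
    (μ.restrict (chartAt (EuclideanSpace ℝ (Fin d)) x).source).map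
        (chartAt (EuclideanSpace ℝ (Fin d)) x) =
      (volume.restrict (chartAt (EuclideanSpace ℝ (Fin d)) x).target).withDensity
        fun y => ENNReal.ofReal (ρ y)

/-- The contraction `α_i s^i`: fibrewise contraction followed by integration over `M`. -/
def contraction (μ : Measure M) (α : X.dual.Γ) (s : X.Γ) : ℝ := ∫ x, pairing α s x ∂μ

/-- `P*` is the formal adjoint of `P : Γ(X) → Γ(Y)`. -/
def IsFormalAdjoint (μ : Measure M) (P : DiffOp X Y) (Pt : DiffOp Y.dual X.dual) : Prop :=
  ∀ α ∈ Γ₀ Y.dual, ∀ s ∈ Γ₀ X, contraction μ α (P s) = contraction μ (Pt α) s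

variable [BorelSpace M]

theorem pairing_integrable (μ : Measure M) [IsLocallyFiniteMeasure μ] (α : Γ₀ X.dual) (s : X.Γ) :
    Integrable (pairing (α : X.dual.Γ) s) μ := by
  refine (pairing_contMDiff _ s).continuous.integrable_of_hasCompactSupport ?_
  refine IsCompact.of_isClosed_subset α.2 isClosed_closure (closure_mono fun x hx h => hx ?_)
  have h' : (α : X.dual.Γ) x = (0 : X.V x →L[ℝ] ℝ) := h
  rw [pairing, h']; rfl

/-- The distributional section defined by a smooth section. -/
def ofSmooth (μ : Measure M) [IsLocallyFiniteMeasure μ] (s : X.Γ) : Distr X.dual where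
  toFun α := contraction μ (α : X.dual.Γ) s
  map_add' α β := by
    rw [contraction, contraction, contraction,
      ← integral_add (pairing_integrable μ α s) (pairing_integrable μ β s)]
    rfl
  map_smul' c α := by
    rw [contraction, contraction, RingHom.id_apply, smul_eq_mul, ← integral_const_mul]
    rfl

end Distributions

/-! ### Field equations, functionals, gauge structure, Lagrange anchors -/

section Theory

variable {d : ℕ} {M : Type u} [TopologicalSpace M] [ChartedSpace (EuclideanSpace ℝ (Fin d)) M]

variable {W D F H : VBundle.{u, v, w} d M}

/-- The field configurations: smooth sections of the bundle `W` with values in `U`. -/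
def Configurations (U : Set (TotalSpace W.F W.V)) : Set W.Γ :=
  {φ | ∀ x, TotalSpace.mk' W.F x (φ x) ∈ U}

/-- `φ` and `ψ` have the same `k`-jet at `x`. -/
def SameJet (k : ℕ) (x : M) (φ ψ : W.Γ) : Prop :=
  ∀ P : W.Γ →ₗ[ℝ] SmoothFun d M, IsDiffOpOfOrder (SmoothFun d M) k P → P φ x = P ψ x

/-- `f[φ](x)` is a smooth function of `x` and of the derivatives of `φ` at `x` up to order `k`: it
depends on the `k`-jet of `φ` at `x` only, and smoothly so along smooth finite-dimensional families
of field configurations. -/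
def IsLocalOfOrder (U : Set (TotalSpace W.F W.V)) (k : ℕ) (f : W.Γ → M → ℝ) : Prop :=
  (∀ φ ∈ Configurations U, ∀ ψ ∈ Configurations U, ∀ x, SameJet k x φ ψ → f φ x = f ψ x) ∧
  ∀ (p : ℕ) (O : Set (EuclideanSpace ℝ (Fin p))) (Φ : EuclideanSpace ℝ (Fin p) → W.Γ),
    IsOpen O → (∀ s ∈ O, Φ s ∈ Configurations U) →
    ContMDiffOn ((𝓡 p).prod (𝓡 d)) ((𝓡 d).prod 𝓘(ℝ, W.F)) ∞
      (fun q : EuclideanSpace ℝ (Fin p) × M => TotalSpace.mk' W.F q.2 (Φ q.1 q.2))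
      (O ×ˢ univ) →
    ContMDiffOn ((𝓡 p).prod (𝓡 d)) 𝓘(ℝ, ℝ) ∞
      (fun q : EuclideanSpace ℝ (Fin p) × M => f (Φ q.1) q.2) (O ×ˢ univ)

variable [MeasurableSpace M]

/-- Local field equations `T_a[φ] = 0` for the sections of `W` with values in the open set `U`.
The tangent bundle of the space of fields has the fibre `Γ(W)`. The dynamics bundle is written as
`E = D*`, so that `E* = D`; every bundle of finite rank is of this form. `J` is the Jacobi operator
`T_{a,i}` and `Jt` is its formal adjoint. -/
structure FieldEquations (μ : Measure M) (W D : VBundle.{u, v, w} d M) where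
  U : Set (TotalSpace W.F W.V)
  isOpen_U : IsOpen U
  T : W.Γ → D.dual.Γ
  isLocal_T : ∃ k, ∀ ξ : D.Γ, IsLocalOfOrder U k fun φ => pairing (T φ) ξ
  J : W.Γ → DiffOp W D.dual
  linearization : ∀ φ ∈ Configurations U, ∀ s ∈ Γ₀ W, ∀ (ξ : D.Γ) (x : M),
    HasDerivAt (fun ε : ℝ => pairing (T (φ + ε • s)) ξ x) (pairing (J φ s) ξ x) 0
  Jt : W.Γ → DiffOp D W.dual
  adjoint : ∀ φ ∈ Configurations U, ∀ s ∈ Γ₀ W, ∀ ξ ∈ Γ₀ D,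
    contraction μ (J φ s) ξ = contraction μ (Jt φ ξ) s

variable {μ : Measure M}

/-- The shell `Σ`: the space of solutions. -/
def FieldEquations.shell (𝒯 : FieldEquations μ W D) : Set W.Γ :=
  {φ | φ ∈ Configurations 𝒯.U ∧ 𝒯.T φ = 0}

/-- Equality on shell of two functionals, `f ≈ g`. -/
def FieldEquations.OnShellEq (𝒯 : FieldEquations μ W D) (f g : W.Γ → ℝ) : Prop :=
  ∀ φ ∈ 𝒯.shell, f φ = g φ

/-- The equations are the Euler-Lagrange equations `S_{,i} = 0` of an action `S = ∫ ℓ`, `ℓ` a local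
density: for compactly supported variations `s` of the field, `δS = ∫ ⟨T, s⟩`. -/
def FieldEquations.IsLagrangian (𝒯 : FieldEquations μ W W) : Prop :=
  ∃ (ℓ : W.Γ → M → ℝ) (k : ℕ), IsLocalOfOrder 𝒯.U k ℓ ∧
    ∀ φ ∈ Configurations 𝒯.U, ∀ s ∈ Γ₀ W,
      HasDerivAt (fun ε : ℝ => ∫ x, (ℓ (φ + ε • s) x - ℓ φ x) ∂μ)
        (contraction μ (𝒯.T φ) s) 0

/-- A differentiable functional `A` of the fields with a compactly supported, possibly
distributional, functional derivative `δA = A_{,i}`. (No higher differentiability is required.) -/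
structure CompactFunctional (𝒯 : FieldEquations μ W D) where
  val : W.Γ → ℝ
  δ : W.Γ → W.Γ →ₗ[ℝ] ℝ
  isCompactDistr : ∀ φ ∈ Configurations 𝒯.U, IsCompactDistr (δ φ)
  hasDerivAt : ∀ φ ∈ Configurations 𝒯.U, ∀ s ∈ Γ₀ W,
    HasDerivAt (fun ε : ℝ => val (φ + ε • s)) (δ φ s) 0

/-- A functional as above whose functional derivative is a smooth section. -/
structure RegularFunctional (𝒯 : FieldEquations μ W D) extends CompactFunctional 𝒯 where
  grad : W.Γ → Γ₀ W.dual
  δ_eq : ∀ φ ∈ Configurations 𝒯.U, ∀ s : W.Γ, δ φ s = contraction μ (grad φ : W.dual.Γ) s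

/-- Generators `R` of gauge symmetries and `L` of gauge identities, with their formal adjoints.
The bundles of gauge symmetries and of gauge identities are `F` and `G = H*`. -/
structure GaugeGenerators (𝒯 : FieldEquations μ W D) (F H : VBundle.{u, v, w} d M) where
  R : W.Γ → DiffOp F W
  Rt : W.Γ → DiffOp W.dual F.dual
  R_adjoint : ∀ φ ∈ Configurations 𝒯.U, IsFormalAdjoint μ (R φ) (Rt φ)
  J_R : ∀ φ ∈ 𝒯.shell, ∀ ε : F.Γ, 𝒯.J φ (R φ ε) = 0
  L : W.Γ → DiffOp D.dual H.dual
  Lt : W.Γ → DiffOp H D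
  L_adjoint : ∀ φ ∈ Configurations 𝒯.U, IsFormalAdjoint μ (Lt φ) (L φ)
  L_T : ∀ φ ∈ Configurations 𝒯.U, L φ (𝒯.T φ) = 0

/-- A gauge invariant functional, `A_{,i} R^i_α ≈ 0`. -/
def GaugeGenerators.IsObservable {𝒯 : FieldEquations μ W D} (𝒢 : GaugeGenerators 𝒯 F H)
    (A : CompactFunctional 𝒯) : Prop :=
  ∀ φ ∈ 𝒯.shell, ∀ ε ∈ Γ₀ F, A.δ φ (𝒢.R φ ε) = 0

/-- A Lagrange anchor `V : Γ(E*) → Γ(T𝓜)` with its formal adjoint: `J ∘ V ≈ V* ∘ J*`. -/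
structure IsLagrangeAnchor (𝒯 : FieldEquations μ W D) (V : W.Γ → DiffOp D W)
    (Vt : W.Γ → DiffOp W.dual D.dual) : Prop where
  adjoint : ∀ φ ∈ Configurations 𝒯.U, IsFormalAdjoint μ (V φ) (Vt φ)
  comm : ∀ φ ∈ 𝒯.shell, ∀ ξ : D.Γ, 𝒯.J φ (V φ ξ) = Vt φ (𝒯.Jt φ ξ)

variable [T2Space M] [IsManifold (𝓡 d) ∞ M]

/-- Acyclicity on shell of the complexes of sections with advanced and with retarded supports
`Γ_±(F) → Γ_±(T𝓜) → Γ_±(E) → Γ_±(G)` and `Γ_±(G*) → Γ_±(E*) → Γ_±(T*𝓜) → Γ_±(F*)` with the maps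
`R, J, L` and `L*, J*, R*`, at the middle terms, for smooth and for distributional sections. -/
def GaugeGenerators.IsAcyclic {𝒯 : FieldEquations μ W D} (𝒢 : GaugeGenerators 𝒯 F H)
    (time : M → ℝ) : Prop :=
  ∀ σ : Dir, ∀ φ ∈ 𝒯.shell,
    ExactPair time σ (𝒢.R φ) (𝒯.J φ) ∧ ExactPair time σ (𝒯.J φ) (𝒢.L φ) ∧
    ExactPair time σ (𝒢.Lt φ) (𝒯.Jt φ) ∧ ExactPair time σ (𝒯.Jt φ) (𝒢.Rt φ)

/-- The advanced/retarded fluctuations `V_A^σ` caused by `A`: (distributional) vector fields with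
`σ`-support such that `V_A^σ T_a ≈ V_a A`. -/
def IsFluctuation (𝒯 : FieldEquations μ W D) (V : W.Γ → DiffOp D W) (time : M → ℝ) (σ : Dir)
    (A : CompactFunctional 𝒯) (q : W.Γ → Distr W.dual) : Prop :=
  ∀ φ ∈ 𝒯.shell, (q φ).IsCausal time σ ∧
    ∀ ξ : Γ₀ D, q φ ((𝒯.Jt φ).onCompact ξ) = A.δ φ (V φ (ξ : D.Γ))

/-- The advanced/retarded repercussions `A_σ` of `A`: (distributional) sections of `E*` with
`σ`-support such that `δA ≈ A_σ^a δT_a`. -/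
def IsRepercussion (𝒯 : FieldEquations μ W D) (time : M → ℝ) (σ : Dir)
    (A : CompactFunctional 𝒯) (ζ : W.Γ → Distr D.dual) : Prop :=
  ∀ φ ∈ 𝒯.shell, (ζ φ).IsCausal time σ ∧
    ∀ s : Γ₀ W, A.δ φ (s : W.Γ) = ζ φ ((𝒯.J φ).onCompact s)

/-- The vector field `ζ^a V_a`. -/
def anchored (Vt : W.Γ → DiffOp W.dual D.dual) (ζ : W.Γ → Distr D.dual) : W.Γ → Distr W.dual :=
  fun φ => ζ φ ∘ₗ (Vt φ).onCompact

/-- The action `q B = q^i B_{,i}` of a distributional vector field on a regular functional. -/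
def distrAct {𝒯 : FieldEquations μ W D} (q : W.Γ → Distr W.dual) (B : RegularFunctional 𝒯) :
    W.Γ → ℝ :=
  fun φ => q φ (B.grad φ)

/-- The action `s A = A_{,i} s^i` of a smooth vector field on an arbitrary functional. -/
def smoothAct {𝒯 : FieldEquations μ W D} (s : W.Γ → W.Γ) (A : CompactFunctional 𝒯) : W.Γ → ℝ :=
  fun φ => A.δ φ (s φ)

/-- The bracket `{A,B}^σ = V_A^σ B - V_B^σ A`, for the fluctuation `q = V_A^σ` of an arbitrary
observable `A` and the smooth fluctuation `s = V_B^σ` of a regular observable `B`. -/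
def bracket {𝒯 : FieldEquations μ W D} (A : CompactFunctional 𝒯) (q : W.Γ → Distr W.dual)
    (B : RegularFunctional 𝒯) (s : W.Γ → W.Γ) : W.Γ → ℝ :=
  distrAct q B - smoothAct s A

/-- The bracket `{B,A}^σ = V_B^σ A - V_A^σ B` of the same two observables in the opposite order. -/
def bracketOpp {𝒯 : FieldEquations μ W D} (A : CompactFunctional 𝒯) (q : W.Γ → Distr W.dual)
    (B : RegularFunctional 𝒯) (s : W.Γ → W.Γ) : W.Γ → ℝ :=
  smoothAct s A - distrAct q B

/-- Advanced/retarded Green functions `G^{±ij}` for the Lagrangian equations `S_{,i} = 0`, as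
operators `α ↦ G^{±ij} α_j`: `G^{±in} S_{,nj} = S_{,jn} G^{±ni} = δ^i_j` on shell; `G^{+ij} = 0` if
`i` is later than `j`, and `G^{-ij} = 0` if `i` is earlier than `j`. -/
def IsGreen (𝒯 : FieldEquations μ W W) (time : M → ℝ)
    (G : Dir → W.Γ → Γ₀ W.dual →ₗ[ℝ] W.Γ) : Prop :=
  ∀ φ ∈ 𝒯.shell, ∀ σ : Dir,
    (∀ s : Γ₀ W, G σ φ ((𝒯.J φ).onCompact s) = s) ∧
    (∀ α : Γ₀ W.dual, 𝒯.J φ (G σ φ α) = α) ∧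
    (∀ α : Γ₀ W.dual, SpatiallyCompact time (VBundle.supp (G σ φ α))) ∧
    ∀ (α : Γ₀ W.dual) (t : ℝ), match σ with
      | .plus => (∀ x ∈ VBundle.supp (α : W.dual.Γ), time x ≤ t) →
          ∀ x ∈ VBundle.supp (G σ φ α), time x ≤ t
      | .minus => (∀ x ∈ VBundle.supp (α : W.dual.Γ), t ≤ time x) →
          ∀ x ∈ VBundle.supp (G σ φ α), t ≤ time x

end Theory

end

/-! ### Supports of smooth sections and cutoffs -/

section Supports

variable {d : ℕ} {M : Type u} [TopologicalSpace M] [ChartedSpace (EuclideanSpace ℝ (Fin d)) M]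
variable {X Y Z : VBundle.{u, v, w} d M}

/-! The core is reciprocity. Let `q` be a fluctuation of `A` on one causal side and `s` a smooth
fluctuation of `B` on the other. Gauge invariance of `B` says `R* δB = 0`, so exactness gives a
smooth `ξ`, supported on the side of `s`, with `J* ξ = δB`. The supports of `q` and `ξ` meet in a
compact set, so the defining equation of `q`, assumed only for compactly supported test sections,
extends to `ξ` (`Distr.apply_eq_of_comp_eq`): `q B = q (J* ξ) = δA (V ξ)`. By `J V ≈ V* J*`, the
section `V ξ` is again a fluctuation of `B`, so `J (V ξ - s) = 0`. Exactness gives `V ξ - s = R ε`,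
and gauge invariance of `A` leaves `q B = δA s` (`reciprocity`).

Repercussions, and their uniqueness modulo the image of `L*`, are direct instances of exactness, the
distributional ones of its transposed half. The anchor identity turns them into fluctuations. Since
reciprocity holds for arbitrary fluctuations, each term of a bracket may be computed with an
anchored repercussion, and the bracket formulas are then algebra.

For Lagrangian equations the anchor condition for `V = 1` is `J = J*`: the second derivative of the
action is symmetric. This is proved on two-parameter affine families of fields, along which the
action is an ordinary function of two variables (`FieldEquations.IsLagrangian.contraction_J_comm`).
A Green function solves `J* ξ = β` for every test section `β`, with `ξ` on the side opposite to `q`.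
The first half of the reciprocity argument therefore determines `q` completely, with neither
exactness nor gauge invariance. -/

theorem VBundle.isClosed_supp (s : X.Γ) : IsClosed (VBundle.supp s) := isClosed_closure

theorem VBundle.eq_zero_of_notMem_supp {s : X.Γ} {x : M} (hx : x ∉ VBundle.supp s) : s x = 0 := by
  by_contra h
  exact hx (subset_closure h)

theorem VBundle.eventually_eq_zero_of_notMem_supp {s : X.Γ} {x : M} (hx : x ∉ VBundle.supp s) :
    ∀ᶠ y in 𝓝 x, s y = 0 := by
  filter_upwards [(VBundle.isClosed_supp s).isOpen_compl.mem_nhds hx] with y hy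
  exact VBundle.eq_zero_of_notMem_supp hy

theorem VBundle.notMem_supp_of_eventually {s : X.Γ} {x : M} (hx : ∀ᶠ y in 𝓝 x, s y = 0) :
    x ∉ VBundle.supp s := by
  intro h
  obtain ⟨y, hy, hy'⟩ := (mem_closure_iff_frequently.1 h).and_eventually hx |>.exists
  exact hy hy'

theorem VBundle.supp_subset_of_isClosed {s : X.Γ} {C : Set M} (hC : IsClosed C)
    (h : ∀ x ∉ C, s x = 0) : VBundle.supp s ⊆ C :=
  closure_minimal (fun x hx => by by_contra h'; exact hx (h x h')) hC

theorem VBundle.supp_sub_subset (s t : X.Γ) :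
    VBundle.supp (s - t) ⊆ VBundle.supp s ∪ VBundle.supp t := by
  refine VBundle.supp_subset_of_isClosed
    ((VBundle.isClosed_supp s).union (VBundle.isClosed_supp t)) fun x hx => ?_
  rw [mem_union, not_or] at hx
  simp [VBundle.eq_zero_of_notMem_supp hx.1, VBundle.eq_zero_of_notMem_supp hx.2]

theorem VBundle.supp_smul_subset_right (f : SmoothFun d M) (s : X.Γ) :
    VBundle.supp (f • s) ⊆ VBundle.supp s := by
  refine VBundle.supp_subset_of_isClosed (VBundle.isClosed_supp s) fun x hx => ?_
  rw [VBundle.smul_apply, VBundle.eq_zero_of_notMem_supp hx, smul_zero]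

theorem VBundle.supp_smul_subset_left (f : SmoothFun d M) (s : X.Γ) :
    VBundle.supp (f • s) ⊆ tsupport f := by
  refine VBundle.supp_subset_of_isClosed (isClosed_tsupport f) fun x hx => ?_
  rw [VBundle.smul_apply, image_eq_zero_of_notMem_tsupport hx, zero_smul]

theorem VBundle.smul_mem_compactSections {f : SmoothFun d M} (hf : HasCompactSupport f) (s : X.Γ) :
    f • s ∈ Γ₀ X :=
  IsCompact.of_isClosed_subset hf (VBundle.isClosed_supp _) (VBundle.supp_smul_subset_left f s)

/-- A smooth cutoff function for a compact set inside an open set. -/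
theorem exists_smooth_cutoff [T2Space M] [SecondCountableTopology M] [IsManifold (𝓡 d) ∞ M]
    {K O : Set M} (hK : IsCompact K) (hO : IsOpen O) (hKO : K ⊆ O) :
    ∃ χ : SmoothFun d M, HasCompactSupport χ ∧ tsupport χ ⊆ O ∧ (∀ x ∈ K, ∀ᶠ y in 𝓝 x, χ y = 1) ∧
      ∀ x, 0 ≤ χ x := by
  have : LocallyCompactSpace M := Manifold.locallyCompact_of_finiteDimensional (𝓡 d)
  obtain ⟨K', hK', hKK', hK'O⟩ := exists_compact_between hK hO hKO
  obtain ⟨f, hf1, hf0, hf⟩ := exists_contMDiffMap_one_nhds_of_subset_interior (𝓡 d) (n := ⊤)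
    hK.isClosed hKK'
  have hts : tsupport f ⊆ K' :=
    closure_minimal (fun x hx => by by_contra h; exact hx (hf0 x h)) hK'.isClosed
  refine ⟨f, hK'.of_isClosed_subset (isClosed_tsupport _) hts, hts.trans hK'O, fun x hx => ?_,
    fun x => (hf x).1⟩
  exact Filter.Eventually.filter_mono (nhds_le_nhdsSet hx) hf1

end Supports

/-! ### Sums and compositions of differential operators -/

section DifferentialOperatorAlgebra

variable {A P Q R : Type*} [CommRing A] [Algebra ℝ A] [AddCommGroup P] [Module ℝ P]
  [Module A P] [SMulCommClass A ℝ P] [AddCommGroup Q] [Module ℝ Q] [Module A Q]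
  [SMulCommClass A ℝ Q] [AddCommGroup R] [Module ℝ R] [Module A R] [SMulCommClass A ℝ R]

theorem mulCommutator_add (D D' : P →ₗ[ℝ] Q) (a : A) :
    mulCommutator (D + D') a = mulCommutator D a + mulCommutator D' a := by
  ext s
  simp [mulCommutator, sub_add_sub_comm]

theorem mulCommutator_zero (a : A) : mulCommutator (0 : P →ₗ[ℝ] Q) a = 0 := by
  ext s
  simp [mulCommutator]

theorem mulCommutator_comp (D' : Q →ₗ[ℝ] R) (D : P →ₗ[ℝ] Q) (a : A) :
    mulCommutator (D' ∘ₗ D) a = D' ∘ₗ mulCommutator D a + mulCommutator D' a ∘ₗ D := by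
  ext s
  simp [mulCommutator]

theorem IsDiffOpOfOrder.zero (k : ℕ) : IsDiffOpOfOrder A k (0 : P →ₗ[ℝ] Q) := by
  induction k with
  | zero => exact fun a => mulCommutator_zero a
  | succ k ih => intro a; rw [mulCommutator_zero]; exact ih

theorem IsDiffOpOfOrder.add {k : ℕ} {D D' : P →ₗ[ℝ] Q} (h : IsDiffOpOfOrder A k D)
    (h' : IsDiffOpOfOrder A k D') : IsDiffOpOfOrder A k (D + D') := by
  induction k generalizing D D' with
  | zero => intro a; rw [mulCommutator_add, h a, h' a, add_zero]
  | succ k ih => intro a; rw [mulCommutator_add]; exact ih (h a) (h' a)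

/-- Commutation with a function is a derivation, so both summands of the commutator of a composite
have total order one less: induction on `k + l`. -/
theorem IsDiffOpOfOrder.comp {k l : ℕ} {D' : Q →ₗ[ℝ] R} {D : P →ₗ[ℝ] Q}
    (h' : IsDiffOpOfOrder A k D') (h : IsDiffOpOfOrder A l D) :
    IsDiffOpOfOrder A (k + l) (D' ∘ₗ D) := by
  induction hn : k + l generalizing k l D D' with
  | zero =>
    obtain ⟨rfl, rfl⟩ := Nat.add_eq_zero_iff.1 hn
    intro a
    rw [mulCommutator_comp, h a, h' a, LinearMap.comp_zero, LinearMap.zero_comp, add_zero]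
  | succ n ih =>
    intro a
    rw [mulCommutator_comp]
    refine IsDiffOpOfOrder.add ?_ ?_
    -- An operator of order zero has vanishing commutators, so its summand drops out and no order
    -- `-1` is needed.
    · cases l with
      | zero => rw [h a, LinearMap.comp_zero]; exact IsDiffOpOfOrder.zero n
      | succ l => exact ih h' (h a) (by omega)
    · cases k with
      | zero => rw [h' a, LinearMap.zero_comp]; exact IsDiffOpOfOrder.zero n
      | succ k => exact ih (h' a) h (by omega)

end DifferentialOperatorAlgebra

/-! ### Locality of differential operators -/

section Locality

variable {d : ℕ} {M : Type u} [TopologicalSpace M] [ChartedSpace (EuclideanSpace ℝ (Fin d)) M]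
  [T2Space M] [IsManifold (𝓡 d) ∞ M] {X Y Z : VBundle.{u, v, w} d M}

/-- If `g x = 1` and `g • s = 0`, then the commutator with `g`, which has lower order, takes the
value `-(P s x)` at `x`. The induction on the order is that of `IsDiffOpOfOrder.apply_eq_zero`, for
function-valued operators. -/
theorem IsDiffOpOfOrder.scalar_apply_eq_zero {k : ℕ} {P : X.Γ →ₗ[ℝ] SmoothFun d M}
    (hP : IsDiffOpOfOrder (SmoothFun d M) k P) {s : X.Γ} {x : M}
    (hs : ∀ᶠ y in 𝓝 x, s y = 0) : P s x = 0 := by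
  obtain ⟨g, hg1, hg0⟩ := exists_cutoff s x hs
  have key : ∀ P : X.Γ →ₗ[ℝ] SmoothFun d M, mulCommutator P g s x = 0 → P s x = 0 := by
    intro P h
    have h2 : (P (g • s) - g • P s) x = 0 := h
    rw [hg0, map_zero, zero_sub] at h2
    have h3 : -(g x * P s x) = 0 := h2
    rwa [hg1, one_mul, neg_eq_zero] at h3
  induction k generalizing P with
  | zero => exact key P (by rw [hP g]; rfl)
  | succ k ih => exact key P (ih (hP g))

theorem DiffOp.apply_eq_of_eventuallyEq (P : DiffOp X Y) {s t : X.Γ} {x : M}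
    (h : ∀ᶠ y in 𝓝 x, s y = t y) : P s x = P t x := by
  obtain ⟨k, hk⟩ := P.isDiffOp
  have : P.toLinearMap (s - t) x = 0 := by
    refine hk.apply_eq_zero k _ _ x ?_
    filter_upwards [h] with y hy
    simp [hy]
  rw [map_sub] at this
  simpa [sub_eq_zero] using this

theorem DiffOp.coe_onCompact (P : DiffOp X Y) (s : Γ₀ X) :
    (P.onCompact s : Y.Γ) = P (s : X.Γ) := rfl

theorem DiffOp.mem_compactSections (P : DiffOp X Y) {s : X.Γ} (hs : s ∈ Γ₀ X) : P s ∈ Γ₀ Y :=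
  (P.onCompact ⟨s, hs⟩).2

theorem SameJet.of_eventuallyEq (k : ℕ) {φ ψ : X.Γ} {x : M} (h : ∀ᶠ y in 𝓝 x, φ y = ψ y) :
    SameJet k x φ ψ := by
  intro P hP
  have : P (φ - ψ) x = 0 := by
    refine hP.scalar_apply_eq_zero ?_
    filter_upwards [h] with y hy
    simp [hy]
  rw [map_sub] at this
  exact sub_eq_zero.1 this

end Locality

/-! ### Advanced and retarded supports -/

section Causality

variable {M : Type u} [TopologicalSpace M] {time : M → ℝ}

theorem SpatiallyCompact.mono {K C : Set M} (hK : SpatiallyCompact time K) (hC : IsClosed C)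
    (h : C ⊆ K) : SpatiallyCompact time C := by
  intro t' t
  have : C ∩ {x | t' ≤ time x ∧ time x ≤ t} = K ∩ {x | t' ≤ time x ∧ time x ≤ t} ∩ C := by
    ext x
    exact ⟨fun hx => ⟨⟨h hx.1, hx.2⟩, hx.1⟩, fun hx => ⟨hx.2, hx.1.2⟩⟩
  rw [this]
  exact (hK t' t).inter_right hC

theorem SpatiallyCompact.union {K C : Set M} (hK : SpatiallyCompact time K)
    (hC : SpatiallyCompact time C) : SpatiallyCompact time (K ∪ C) := by
  intro t' t
  rw [union_inter_distrib_right]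
  exact (hK t' t).union (hC t' t)

theorem CausalSupport.mono {σ : Dir} {K C : Set M} (hK : CausalSupport time σ K)
    (hC : IsClosed C) (h : C ⊆ K) : CausalSupport time σ C := by
  cases σ <;> exact ⟨hK.1.mono hC h, hK.2.imp fun t ht x hx => ht x (h hx)⟩

theorem CausalSupport.union {σ : Dir} {K C : Set M} (hK : CausalSupport time σ K)
    (hC : CausalSupport time σ C) : CausalSupport time σ (K ∪ C) := by
  cases σ with
  | plus =>
    obtain ⟨hK, t, ht⟩ := hK
    obtain ⟨hC, t', ht'⟩ := hC
    refine ⟨hK.union hC, min t t', fun x hx => ?_⟩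
    exact hx.elim (fun h => (min_le_left _ _).trans (ht x h))
      fun h => (min_le_right _ _).trans (ht' x h)
  | minus =>
    obtain ⟨hK, t, ht⟩ := hK
    obtain ⟨hC, t', ht'⟩ := hC
    refine ⟨hK.union hC, max t t', fun x hx => ?_⟩
    exact hx.elim (fun h => (ht x h).trans (le_max_left _ _))
      fun h => (ht' x h).trans (le_max_right _ _)

theorem CausalSupport.spatiallyCompact {σ : Dir} {K : Set M} (hK : CausalSupport time σ K) :
    SpatiallyCompact time K := by
  cases σ <;> exact hK.1

/-- A set with advanced support and one with retarded support meet in a compact set. -/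
theorem CausalSupport.isCompact_inter {σ : Dir} {K C : Set M} (hK : CausalSupport time σ K)
    (hC : CausalSupport time σ.opp C) (hC' : IsClosed C) : IsCompact (K ∩ C) := by
  have key : ∀ t' t : ℝ, (∀ x ∈ K ∩ C, t' ≤ time x ∧ time x ≤ t) → IsCompact (K ∩ C) := by
    intro t' t h
    have : K ∩ C = K ∩ {x | t' ≤ time x ∧ time x ≤ t} ∩ C := by
      ext x
      exact ⟨fun hx => ⟨⟨hx.1, h x hx⟩, hx.2⟩, fun hx => ⟨hx.1.1, hx.2⟩⟩
    rw [this]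
    exact (hK.spatiallyCompact t' t).inter_right hC'
  cases σ with
  | plus =>
    obtain ⟨-, t', ht'⟩ := hK
    obtain ⟨-, t, ht⟩ := hC
    exact key t' t fun x hx => ⟨ht' x hx.1, ht x hx.2⟩
  | minus =>
    obtain ⟨-, t, ht⟩ := hK
    obtain ⟨-, t', ht'⟩ := hC
    exact key t' t fun x hx => ⟨ht' x hx.2, ht x hx.1⟩

theorem IsCompact.causalSupport (htime : Continuous time) {K : Set M} (hK : IsCompact K)
    (σ : Dir) : CausalSupport time σ K := by
  have hs : SpatiallyCompact time K := fun t' t =>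
    hK.inter_right ((isClosed_le continuous_const htime).inter (isClosed_le htime continuous_const))
  cases σ with
  | plus =>
    obtain ⟨t, ht⟩ := (hK.image htime).bddBelow
    exact ⟨hs, t, fun x hx => ht (mem_image_of_mem _ hx)⟩
  | minus =>
    obtain ⟨t, ht⟩ := (hK.image htime).bddAbove
    exact ⟨hs, t, fun x hx => ht (mem_image_of_mem _ hx)⟩

theorem Dir.opp_opp (σ : Dir) : σ.opp.opp = σ := by cases σ <;> rfl

end Causality

/-! ### Distributional sections: supports, continuity, extension to noncompact test sections -/

section DistributionalSections

variable {d : ℕ} {M : Type u} [TopologicalSpace M] [ChartedSpace (EuclideanSpace ℝ (Fin d)) M]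
variable {X Y Z : VBundle.{u, v, w} d M}

theorem BoundedOn.mono {D D' : List (Y.Γ →ₗ[ℝ] SmoothFun d M)} {K : Set M} {s : Y.Γ} {B : ℝ}
    (h : BoundedOn D' K s B) (hD : D ⊆ D') : BoundedOn D K s B :=
  fun P hP => h P (hD hP)

theorem Distr.isClosed_supp (q : Distr Y) : IsClosed q.supp := by
  refine isOpen_compl_iff.1 (isOpen_iff_mem_nhds.2 fun x hx => ?_)
  simp only [Distr.supp, mem_compl_iff, mem_ofPred_eq, not_forall] at hx
  obtain ⟨O, hO, h⟩ := hx
  filter_upwards [eventually_mem_nhds_iff.2 hO] with y hy hy'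
  exact h (hy' O hy)

theorem Distr.supp_sub_subset (q q' : Distr Y) : (q - q').supp ⊆ q.supp ∪ q'.supp := by
  intro x hx
  by_contra h
  simp only [mem_union, not_or, Distr.supp, mem_ofPred_eq, not_forall] at h
  obtain ⟨⟨O, hO, h⟩, O', hO', h'⟩ := h
  push Not at h h'
  obtain ⟨s, hs, hne⟩ := hx (O ∩ O') (Filter.inter_mem hO hO')
  refine hne ?_
  rw [LinearMap.sub_apply, h s (hs.trans inter_subset_left), h' s (hs.trans inter_subset_right),
    sub_zero]

theorem Distr.IsContinuous.sub {q q' : Distr Y} (h : q.IsContinuous) (h' : q'.IsContinuous) :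
    (q - q').IsContinuous := by
  intro K hK
  obtain ⟨C, D, hD, hq⟩ := h K hK
  obtain ⟨C', D', hD', hq'⟩ := h' K hK
  refine ⟨C + C', D ++ D', fun P hP => (List.mem_append.1 hP).elim (hD P) (hD' P),
    fun s B hs hB hb => ?_⟩
  calc |(q - q') s| ≤ |q s| + |q' s| := abs_sub _ _
    _ ≤ C * B + C' * B := add_le_add (hq s B hs hB (hb.mono (List.subset_append_left _ _)))
        (hq' s B hs hB (hb.mono (List.subset_append_right _ _)))
    _ = (C + C') * B := by ring

theorem Distr.IsCausal.sub {time : M → ℝ} {σ : Dir} {q q' : Distr Y} (h : q.IsCausal time σ)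
    (h' : q'.IsCausal time σ) : (q - q').IsCausal time σ :=
  ⟨h.1.sub h'.1, (h.2.union h'.2).mono (Distr.isClosed_supp _) (Distr.supp_sub_subset _ _)⟩

section Local

variable [T2Space M] [IsManifold (𝓡 d) ∞ M]

theorem Distr.supp_comp_subset (q : Distr Y) (P : DiffOp X Y) : 
    Distr.supp (q ∘ₗ P.onCompact) ⊆ q.supp := by
  intro x hx O hO
  obtain ⟨s, hs, hne⟩ := hx O hO
  exact ⟨P.onCompact s, (P.supp_subset _).trans hs, hne⟩

theorem Distr.IsContinuous.comp {q : Distr Y} (h : q.IsContinuous) (P : DiffOp X Y) :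
    Distr.IsContinuous (q ∘ₗ P.onCompact) := by
  intro K hK
  obtain ⟨C, D, hD, hq⟩ := h K hK
  obtain ⟨l, hl⟩ := P.isDiffOp
  refine ⟨C, D.map (· ∘ₗ P.toLinearMap), ?_, fun s B hs hB hb => ?_⟩
  · intro Q hQ
    obtain ⟨Q', hQ', rfl⟩ := List.mem_map.1 hQ
    obtain ⟨k, hk⟩ := hD Q' hQ'
    exact ⟨k + l, hk.comp hl⟩
  · refine hq (P.onCompact s) B ((P.supp_subset _).trans hs) hB fun Q hQ x hx => ?_
    exact hb _ (List.mem_map_of_mem hQ) x hx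

theorem Distr.IsCausal.comp {time : M → ℝ} {σ : Dir} {q : Distr Y} (h : q.IsCausal time σ)
    (P : DiffOp X Y) : Distr.IsCausal time σ (q ∘ₗ P.onCompact) :=
  ⟨h.1.comp P, h.2.mono (Distr.isClosed_supp _) (q.supp_comp_subset P)⟩

/-- A compactly supported distributional section only depends on germs along a compact set. -/
theorem IsCompactDistr.exists_isCompact {a : Y.Γ →ₗ[ℝ] ℝ} (ha : IsCompactDistr a) :
    ∃ K : Set M, IsCompact K ∧ ∀ s t : Y.Γ, (∀ x ∈ K, ∀ᶠ y in 𝓝 x, s y = t y) → a s = a t := by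
  obtain ⟨K, C, D, hK, hD, h⟩ := ha
  refine ⟨K, hK, fun s t hst => ?_⟩
  -- The continuity estimate is used with the bound `0`: all derivatives of `s - t` vanish on `K`.
  have h0 : |a (s - t)| ≤ C * 0 := by
    refine h _ 0 le_rfl fun P hP x hx => ?_
    obtain ⟨k, hk⟩ := hD P hP
    rw [hk.scalar_apply_eq_zero (s := s - t), abs_zero]
    filter_upwards [hst x hx] with y hy
    simp [hy]
  rw [mul_zero, map_sub] at h0
  exact sub_eq_zero.1 (abs_nonpos_iff.1 h0)

theorem IsCompactDistr.isCausal {time : M → ℝ} (htime : Continuous time) {a : Y.Γ →ₗ[ℝ] ℝ}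
    (ha : IsCompactDistr a) (σ : Dir) :
    Distr.IsCausal time σ (a ∘ₗ (Γ₀ Y).subtype : Distr Y) := by
  refine ⟨fun K' _ => ?_, ?_⟩
  · obtain ⟨K, C, D, hK, hD, h⟩ := ha
    -- The estimate for `a` asks for bounds on `K`, whereas bounds are given on `K'` only. Outside
    -- `K'` the section, hence each derivative of it, vanishes.
    refine ⟨C, D, hD, fun s B hs hB hb => h s B hB fun P hP x _ => ?_⟩
    by_cases hx : x ∈ K'
    · exact hb P hP x hx
    · obtain ⟨k, hk⟩ := hD P hP
      rw [hk.scalar_apply_eq_zero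
        (VBundle.eventually_eq_zero_of_notMem_supp fun h => hx (hs h)), abs_zero]
      exact hB
  · obtain ⟨K, hK, h⟩ := ha.exists_isCompact
    refine (hK.causalSupport htime σ).mono (Distr.isClosed_supp _) fun x hx => ?_
    by_contra hxK
    obtain ⟨s, hs, hne⟩ := hx Kᶜ (hK.isClosed.isOpen_compl.mem_nhds hxK)
    refine hne ((h s 0 fun y hy => ?_).trans (map_zero a))
    exact VBundle.eventually_eq_zero_of_notMem_supp fun h => hs h hy

variable [SecondCountableTopology M]

/-- The definition of the support gives vanishing near each point only. Compactness patches finitely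
many neighbourhoods together, cutting test sections in two rather than using a partition of unity.
-/
theorem Distr.exists_isOpen_forall_eq_zero (q : Distr Y) {K : Set M} (hK : IsCompact K)
    (h : Disjoint K q.supp) :
    ∃ O, IsOpen O ∧ K ⊆ O ∧ ∀ s : Γ₀ Y, VBundle.supp (s : Y.Γ) ⊆ O → q s = 0 := by
  refine hK.induction_on
    (p := fun K => ∃ O, IsOpen O ∧ K ⊆ O ∧ ∀ s : Γ₀ Y, VBundle.supp (s : Y.Γ) ⊆ O → q s = 0)
    ⟨∅, isOpen_empty, subset_rfl, fun s hs => ?_⟩ ?_ ?_ fun x hx => ?_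
  · have : s = 0 := by
      ext x
      exact VBundle.eq_zero_of_notMem_supp fun hx => hs hx
    rw [this, map_zero]
  · rintro K K' hKK' ⟨O, hO, hKO, h⟩
    exact ⟨O, hO, hKK'.trans hKO, h⟩
  · rintro K K' ⟨O, hO, hKO, h⟩ ⟨O', hO', hKO', h'⟩
    refine ⟨O ∪ O', hO.union hO', union_subset_union hKO hKO', fun s hs => ?_⟩
    -- The part of the support of `s` outside `O'` is compact and lies in `O`. With `χ = 1` near it,
    -- `χ • s` is supported in `O` and `s - χ • s` in `O'`.
    obtain ⟨χ, hχc, hχO, hχ1, -⟩ := exists_smooth_cutoff (d := d)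
      (IsCompact.diff s.2 hO') hO (sdiff_subset_iff.2 (union_comm O O' ▸ hs))
    let s₁ : Γ₀ Y := ⟨χ • (s : Y.Γ), VBundle.smul_mem_compactSections hχc _⟩
    have h₁ : q s₁ = 0 := h s₁ ((VBundle.supp_smul_subset_left _ _).trans hχO)
    have h₂ : q (s - s₁) = 0 := by
      refine h' _ fun x hx => ?_
      by_contra hxO
      have hxs : x ∈ VBundle.supp (s : Y.Γ) :=
        (VBundle.supp_sub_subset _ _ hx).elim id fun h => VBundle.supp_smul_subset_right _ _ h
      refine VBundle.notMem_supp_of_eventually ?_ hx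
      filter_upwards [hχ1 x ⟨hxs, hxO⟩] with y hy
      change (s : Y.Γ) y - χ y • (s : Y.Γ) y = 0
      rw [hy, one_smul, sub_self]
    rwa [map_sub, h₁, sub_zero] at h₂
  · have hx' := disjoint_left.1 h hx
    simp only [Distr.supp, mem_ofPred_eq, not_forall] at hx'
    obtain ⟨O, hO, hq⟩ := hx'
    push Not at hq
    exact ⟨interior O, mem_nhdsWithin_of_mem_nhds (interior_mem_nhds.2 hO), interior O,
      isOpen_interior, subset_rfl, fun s hs => hq s (hs.trans interior_subset)⟩

theorem Distr.apply_eq_zero_of_disjoint (q : Distr Y) (s : Γ₀ Y)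
    (h : Disjoint (VBundle.supp (s : Y.Γ)) q.supp) : q s = 0 := by
  obtain ⟨O, -, hsO, hq⟩ := q.exists_isOpen_forall_eq_zero s.2 h
  exact hq s hsO

/-- If `q ∘ P` agrees with a compactly supported distributional section on compactly supported
test sections, then it does so on all sections whose support meets that of `q` in a compact set. -/
theorem Distr.apply_eq_of_comp_eq {q : Distr Y} {P : DiffOp X Y} {V : DiffOp X Z}
    {a : Z.Γ →ₗ[ℝ] ℝ} (ha : IsCompactDistr a)
    (hq : ∀ ξ : Γ₀ X, q (P.onCompact ξ) = a (V (ξ : X.Γ))) {ξ : X.Γ} {β : Γ₀ Y} (hβ : P ξ = β)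
    (hc : IsCompact (q.supp ∩ VBundle.supp ξ)) : q β = a (V ξ) := by
  obtain ⟨K, hK, haK⟩ := ha.exists_isCompact
  -- One cutoff serves both sides: it is `1` near the set `K` that determines `a`, and near the
  -- overlap of the supports of `q` and `ξ`.
  obtain ⟨χ, hχc, -, hχ1, -⟩ := exists_smooth_cutoff (d := d) (hK.union hc) isOpen_univ
    (subset_univ _)
  let ξ' : Γ₀ X := ⟨χ • ξ, VBundle.smul_mem_compactSections hχc ξ⟩
  have hξ' : ∀ x ∈ K ∪ q.supp ∩ VBundle.supp ξ, ∀ᶠ y in 𝓝 x, (ξ' : X.Γ) y = ξ y := by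
    intro x hx
    filter_upwards [hχ1 x hx] with y hy
    change χ y • ξ y = ξ y
    rw [hy, one_smul]
  have h₁ : a (V (ξ' : X.Γ)) = a (V ξ) := by
    refine haK _ _ fun x hx => ?_
    filter_upwards [(hξ' x (Or.inl hx)).eventually_nhds] with y hy
    exact V.apply_eq_of_eventuallyEq hy
  -- Near a point of the support of `q`, either `χ = 1` or `ξ = 0`. Hence `P ξ'` and `β = P ξ`
  -- differ only away from that support.
  have h₂ : q (P.onCompact ξ' - β) = 0 := by
    refine q.apply_eq_zero_of_disjoint _ (disjoint_left.2 fun x hx hxq => ?_)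
    refine VBundle.notMem_supp_of_eventually ?_ hx
    have : ∀ᶠ y in 𝓝 x, (ξ' : X.Γ) y = ξ y := by
      by_cases hxξ : x ∈ VBundle.supp ξ
      · exact hξ' x (Or.inr ⟨hxq, hxξ⟩)
      · filter_upwards [VBundle.eventually_eq_zero_of_notMem_supp hxξ] with y hy
        change χ y • ξ y = ξ y
        rw [hy, smul_zero]
    filter_upwards [this.eventually_nhds] with y hy
    change P (ξ' : X.Γ) y - (β : Y.Γ) y = 0
    rw [P.apply_eq_of_eventuallyEq hy, hβ, sub_self]
  rw [map_sub, sub_eq_zero] at h₂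
  rw [← h₂, hq, h₁]

end Local

end DistributionalSections

/-! ### Fibrewise pairing and sections with prescribed values -/

section SmoothSections

variable {d : ℕ} {M : Type u} [TopologicalSpace M] [ChartedSpace (EuclideanSpace ℝ (Fin d)) M]
variable {X Y Z : VBundle.{u, v, w} d M}

theorem pairing_smul_right (f : SmoothFun d M) (α : X.dual.Γ) (s : X.Γ) (x : M) :
    pairing α (f • s) x = f x * pairing α s x :=
  map_smul (show X.V x →L[ℝ] ℝ from α x) (f x) (s x)

theorem pairing_smul_left (f : SmoothFun d M) (α : X.dual.Γ) (s : X.Γ) (x : M) :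
    pairing (f • α) s x = f x * pairing α s x := rfl

theorem pairing_eq_zero_of_left {α : X.dual.Γ} {x : M} (h : α x = 0) (s : X.Γ) :
    pairing α s x = 0 := by
  have h' : α x = (0 : X.V x →L[ℝ] ℝ) := h
  rw [pairing, h']
  rfl

theorem pairing_eq_zero_of_right {s : X.Γ} {x : M} (h : s x = 0) (α : X.dual.Γ) :
    pairing α s x = 0 := by
  rw [pairing, h, map_zero]

theorem pairing_congr {α β : X.dual.Γ} {s t : X.Γ} {x : M} (h : α x = β x) (h' : s x = t x) :
    pairing α s x = pairing β t x := by
  rw [pairing, pairing, h, h']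

theorem pairing_sub_right (α : X.dual.Γ) (s t : X.Γ) (x : M) :
    pairing α (s - t) x = pairing α s x - pairing α t x :=
  map_sub (show X.V x →L[ℝ] ℝ from α x) (s x) (t x)

/-- The contraction with a fixed section, as a scalar differential operator. -/
noncomputable def pairingLinear (s : X.Γ) : X.dual.Γ →ₗ[ℝ] SmoothFun d M where
  toFun α := ⟨pairing α s, pairing_contMDiff α s⟩
  map_add' _ _ := rfl
  map_smul' _ _ := rfl

theorem pairingLinear_isDiffOp (s : X.Γ) : IsDiffOpOfOrder (SmoothFun d M) 0 (pairingLinear s) := by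
  intro f
  ext α x
  exact sub_eq_zero.2 (pairing_smul_left f α s x)

variable [T2Space M] [IsManifold (𝓡 d) ∞ M]

theorem VBundle.exists_section_apply_eq (X : VBundle.{u, v, w} d M) {x : M} (z : X.V x) :
    ∃ s : X.Γ, s x = z := by
  obtain ⟨O, hO, hs⟩ := FiberBundle.exists_contMDiffOn_extend (𝓡 d) X.F (k := ∞) z
  obtain ⟨f, hf, hfO⟩ := (SmoothBumpFunction.nhds_basis_tsupport (I := 𝓡 d) x).mem_iff.1
    (interior_mem_nhds.2 hO)
  refine ⟨⟨_, ContMDiffOn.smul_section_of_tsupport f.contMDiff.contMDiffOn isOpen_interior hfO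
    (hs.mono interior_subset)⟩, ?_⟩
  change f x • FiberBundle.extend X.F z x = z
  rw [f.eq_one, one_smul]
  simp

theorem VBundle.exists_dual_section_ne_zero {s : X.Γ} {x : M} (h : s x ≠ 0) :
    ∃ α : X.dual.Γ, pairing α s x ≠ 0 := by
  let e := (trivializationAt X.F X.V x).continuousLinearEquivAt ℝ x
    (FiberBundle.mem_baseSet_trivializationAt' x)
  have he : e (s x) ≠ 0 := fun h0 => h (e.map_eq_zero_iff.1 h0)
  obtain ⟨l, -, hl⟩ := exists_dual_vector ℝ (e (s x)) (norm_ne_zero_iff.2 he)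
  obtain ⟨α, hα⟩ := VBundle.exists_section_apply_eq X.dual (x := x)
    (show X.V x →L[ℝ] ℝ from l.comp (e : X.V x →L[ℝ] X.F))
  refine ⟨α, ?_⟩
  rw [pairing, hα]
  change l (e (s x)) ≠ 0
  rw [hl]
  simpa using he

end SmoothSections

/-! ### The fundamental lemma of the calculus of variations -/

section FundamentalLemma

variable {d : ℕ} {M : Type u} [TopologicalSpace M] [ChartedSpace (EuclideanSpace ℝ (Fin d)) M]
variable {X Y Z : VBundle.{u, v, w} d M}
variable [MeasurableSpace M] {μ : Measure M}

theorem contraction_smul_comm (f : SmoothFun d M) (α : X.dual.Γ) (s : X.Γ) :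
    contraction μ (f • α) s = contraction μ α (f • s) :=
  integral_congr_ae (.of_forall fun x => by
    simp only [pairing_smul_left, pairing_smul_right])

variable [BorelSpace M]

/-- A null nonempty open set would have, in a chart, a nonempty open image of zero Lebesgue measure,
because the density is positive. -/
theorem IsSmoothVolume.isOpenPosMeasure (hμ : IsSmoothVolume d μ) : μ.IsOpenPosMeasure := by
  refine ⟨fun O hO ⟨x, hx⟩ h0 => ?_⟩
  obtain ⟨ρ, hρ, hpos, hmap⟩ := hμ x
  set e := chartAt (EuclideanSpace ℝ (Fin d)) x
  have hS : IsOpen (e.target ∩ e.symm ⁻¹' O) := e.isOpen_inter_preimage_symm hO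
  have he : AEMeasurable e (μ.restrict e.source) :=
    e.continuousOn.aemeasurable e.open_source.measurableSet
  have h1 : (μ.restrict e.source).map e (e.target ∩ e.symm ⁻¹' O) = 0 := by
    rw [Measure.map_apply_of_aemeasurable he hS.measurableSet,
      Measure.restrict_apply' e.open_source.measurableSet]
    refine measure_mono_null (fun y hy => ?_) h0
    have h2 : e.symm (e y) ∈ O := hy.1.2
    rwa [e.left_inv hy.2] at h2
  have hρm : AEMeasurable (fun y => ENNReal.ofReal (ρ y)) (volume.restrict e.target) :=
    (hρ.continuousOn.aemeasurable e.open_target.measurableSet).ennreal_ofReal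
  rw [hmap, withDensity_apply_eq_zero' hρm, Measure.restrict_apply' e.open_target.measurableSet]
    at h1
  refine (hS.measure_pos volume ⟨e x, e.map_source (mem_chart_source _ x), ?_⟩).ne'
    (measure_mono_null (fun y hy => ?_) h1)
  · rwa [mem_preimage, e.left_inv (mem_chart_source _ x)]
  · exact ⟨⟨(ENNReal.ofReal_pos.2 (hpos y hy.1)).ne', hy⟩, hy.1⟩

variable [T2Space M] [SecondCountableTopology M] [IsManifold (𝓡 d) ∞ M]

/-- Testing with `f = χ ⟨α, s⟩`, where `χ ≥ 0` is a cutoff with `χ x = 1`, gives `∫ χ ⟨α, s⟩² = 0`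
with a continuous nonnegative integrand. -/
theorem pairing_eq_zero_of_contraction [IsLocallyFiniteMeasure μ] [μ.IsOpenPosMeasure]
    {α : X.dual.Γ} {s : X.Γ} {O : Set M} (hO : IsOpen O)
    (h : ∀ f : SmoothFun d M, HasCompactSupport f → tsupport f ⊆ O → contraction μ α (f • s) = 0)
    {x : M} (hx : x ∈ O) : pairing α s x = 0 := by
  obtain ⟨χ, hχc, hχO, hχ1, hχ0⟩ := exists_smooth_cutoff (d := d) (isCompact_singleton (x := x)) hO
    (singleton_subset_iff.2 hx)
  let g : SmoothFun d M := ⟨pairing α s, pairing_contMDiff α s⟩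
  have hts : tsupport (χ * g : SmoothFun d M) ⊆ tsupport χ := tsupport_mul_subset_left
  have h0 := h (χ * g) (hχc.of_isClosed_subset (isClosed_tsupport _) hts) (hts.trans hχO)
  by_contra hne
  have hcont : Continuous fun y => χ y * pairing α s y * pairing α s y :=
    ((χ.contMDiff.continuous.mul g.contMDiff.continuous).mul g.contMDiff.continuous)
  have hpos : 0 < ∫ y, χ y * pairing α s y * pairing α s y ∂μ := by
    refine hcont.integral_pos_of_hasCompactSupport_nonneg_nonzero ?_ ?_ (x := x) ?_
    · exact (hχc.mul_right (f' := pairing α s)).mul_right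
    · intro y
      simp only [Pi.zero_apply, mul_assoc]
      exact mul_nonneg (hχ0 y) (mul_self_nonneg _)
    · simp [(hχ1 x rfl).self_of_nhds, hne]
  refine hpos.ne' (Eq.trans (integral_congr_ae (.of_forall fun y => ?_)) h0)
  rw [pairing_smul_right]
  rfl

/-- The fundamental lemma of the calculus of variations. -/
theorem eq_zero_of_contraction_eq_zero [IsLocallyFiniteMeasure μ] [μ.IsOpenPosMeasure]
    {α : X.dual.Γ} (h : ∀ s ∈ Γ₀ X, contraction μ α s = 0) : α = 0 := by
  ext x : 1
  refine ContinuousLinearMap.ext fun z => ?_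
  obtain ⟨s, rfl⟩ := X.exists_section_apply_eq z
  exact pairing_eq_zero_of_contraction (μ := μ) isOpen_univ
    (fun f hf _ => h _ (VBundle.smul_mem_compactSections hf s)) (mem_univ x)

theorem VBundle.apply_eq_zero_of_contraction [IsLocallyFiniteMeasure μ] [μ.IsOpenPosMeasure]
    {s : X.Γ} {O : Set M} (hO : IsOpen O)
    (h : ∀ α ∈ Γ₀ X.dual, VBundle.supp α ⊆ O → contraction μ α s = 0) {x : M} (hx : x ∈ O) :
    s x = 0 := by
  by_contra hne
  obtain ⟨α, hα⟩ := VBundle.exists_dual_section_ne_zero hne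
  refine hα (pairing_eq_zero_of_contraction (μ := μ) hO (fun f hf hfO => ?_) hx)
  rw [← contraction_smul_comm]
  exact h _ (VBundle.smul_mem_compactSections hf α) ((VBundle.supp_smul_subset_left _ _).trans hfO)

end FundamentalLemma

/-! ### Smooth sections as distributional sections -/

section RegularDistributions

variable {d : ℕ} {M : Type u} [TopologicalSpace M] [ChartedSpace (EuclideanSpace ℝ (Fin d)) M]
variable {X Y Z : VBundle.{u, v, w} d M}
variable [MeasurableSpace M] [BorelSpace M] {μ : Measure M} [IsLocallyFiniteMeasure μ]

theorem ofSmooth_apply (s : X.Γ) (α : Γ₀ X.dual) :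
    ofSmooth μ s α = contraction μ (α : X.dual.Γ) s := rfl

theorem ofSmooth_sub (s t : X.Γ) : ofSmooth μ (s - t) = ofSmooth μ s - ofSmooth μ t := by
  ext α
  rw [LinearMap.sub_apply, ofSmooth_apply, ofSmooth_apply, ofSmooth_apply, contraction,
    contraction, contraction, ← integral_sub (pairing_integrable μ α s) (pairing_integrable μ α t)]
  exact integral_congr_ae (.of_forall fun x => pairing_sub_right _ s t x)

theorem pairing_integrable_of_right (α : X.dual.Γ) (s : Γ₀ X) :
    Integrable (pairing α (s : X.Γ)) μ := by
  refine (pairing_contMDiff _ _).continuous.integrable_of_hasCompactSupport ?_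
  refine IsCompact.of_isClosed_subset s.2 isClosed_closure (closure_mono fun x hx h => hx ?_)
  exact pairing_eq_zero_of_right h α

theorem ofSmooth_isContinuous [T2Space M] (s : X.Γ) : (ofSmooth μ s).IsContinuous := by
  intro K hK
  -- A smooth section has order zero as a distribution: the integral over `K` is at most the volume
  -- of `K` times the supremum of the pairing.
  refine ⟨μ.real K, [pairingLinear s], fun P hP => ⟨0, ?_⟩, fun α B hα hB hb => ?_⟩
  · rw [List.mem_singleton.1 hP]
    exact pairingLinear_isDiffOp s
  · have hz : ∀ x ∉ K, pairing (α : X.dual.Γ) s x = 0 := fun x hx =>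
      pairing_eq_zero_of_left (VBundle.eq_zero_of_notMem_supp fun h => hx (hα h)) s
    rw [ofSmooth_apply, contraction, ← setIntegral_eq_integral_of_forall_compl_eq_zero hz,
      ← Real.norm_eq_abs, mul_comm]
    exact norm_setIntegral_le_of_norm_le_const hK.measure_lt_top
      fun x hx => hb _ (List.mem_singleton.2 rfl) x hx

theorem ofSmooth_supp_subset (s : X.Γ) : (ofSmooth μ s).supp ⊆ VBundle.supp s := by
  intro x hx
  by_contra h
  obtain ⟨α, hα, hne⟩ := hx _ ((VBundle.isClosed_supp s).isOpen_compl.mem_nhds h)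
  refine hne (integral_eq_zero_of_ae (.of_forall fun y => ?_))
  by_cases hy : y ∈ VBundle.supp s
  · exact pairing_eq_zero_of_left (VBundle.eq_zero_of_notMem_supp fun h => hα h hy) s
  · exact pairing_eq_zero_of_right (VBundle.eq_zero_of_notMem_supp hy) _

variable [T2Space M] {time : M → ℝ} {σ : Dir}

theorem ofSmooth_isCausal {s : X.Γ} (hs : CausalSupport time σ (VBundle.supp s)) :
    (ofSmooth μ s).IsCausal time σ :=
  ⟨ofSmooth_isContinuous s, hs.mono (Distr.isClosed_supp _) (ofSmooth_supp_subset s)⟩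

variable [SecondCountableTopology M] [IsManifold (𝓡 d) ∞ M] [μ.IsOpenPosMeasure]

theorem supp_subset_ofSmooth_supp (s : X.Γ) : VBundle.supp s ⊆ (ofSmooth μ s).supp := by
  refine VBundle.supp_subset_of_isClosed (Distr.isClosed_supp _) fun x hx => ?_
  simp only [Distr.supp, mem_ofPred_eq, not_forall] at hx
  obtain ⟨O, hO, hq⟩ := hx
  push Not at hq
  exact VBundle.apply_eq_zero_of_contraction (μ := μ) isOpen_interior
    (fun α hα hαO => hq ⟨α, hα⟩ (hαO.trans interior_subset)) (mem_interior_iff_mem_nhds.2 hO)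

/-- Fluctuations and repercussions carry the distributional support condition, and exactness for
smooth sections asks for the classical one. This passes between the two. -/
theorem ofSmooth_isCausal_iff {s : X.Γ} :
    (ofSmooth μ s).IsCausal time σ ↔ CausalSupport time σ (VBundle.supp s) :=
  ⟨fun h => h.2.mono (VBundle.isClosed_supp s) (supp_subset_ofSmooth_supp s), ofSmooth_isCausal⟩

theorem eq_zero_of_ofSmooth_eq_zero {s : X.Γ} (h : ofSmooth μ s = 0) : s = 0 := by
  ext x
  exact VBundle.apply_eq_zero_of_contraction (μ := μ) isOpen_univ
    (fun α hα _ => LinearMap.congr_fun h ⟨α, hα⟩) (mem_univ x)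

end RegularDistributions

/-! ### Adjoint identities with only one compactly supported argument -/

section FormalAdjoints

variable {d : ℕ} {M : Type u} [TopologicalSpace M] [ChartedSpace (EuclideanSpace ℝ (Fin d)) M]
variable {X Y Z : VBundle.{u, v, w} d M}
variable [T2Space M] [SecondCountableTopology M] [IsManifold (𝓡 d) ∞ M]

theorem VBundle.exists_compactSection_eventuallyEq {K : Set M} (hK : IsCompact K) (s : X.Γ) :
    ∃ s' ∈ Γ₀ X, ∀ x ∈ K, ∀ᶠ y in 𝓝 x, s' y = s y := by
  obtain ⟨χ, hχc, -, hχ1, -⟩ := exists_smooth_cutoff (d := d) hK isOpen_univ (subset_univ _)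
  refine ⟨χ • s, VBundle.smul_mem_compactSections hχc s, fun x hx => ?_⟩
  filter_upwards [hχ1 x hx] with y hy
  rw [VBundle.smul_apply, hy, one_smul]

variable [MeasurableSpace M] {μ : Measure M}

/-- The defining identity of an adjoint holds if one of the two sections has compact support. -/
theorem contraction_adjoint_of_left {P : DiffOp X Y.dual} {Pt : DiffOp Y X.dual}
    (h : ∀ s ∈ Γ₀ X, ∀ ξ ∈ Γ₀ Y, contraction μ (P s) ξ = contraction μ (Pt ξ) s)
    {s : X.Γ} (hs : s ∈ Γ₀ X) (ξ : Y.Γ) : contraction μ (P s) ξ = contraction μ (Pt ξ) s := by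
  obtain ⟨ξ', hξ', heq⟩ := VBundle.exists_compactSection_eventuallyEq hs ξ
  have h₁ : contraction μ (P s) ξ' = contraction μ (P s) ξ := by
    refine integral_congr_ae (.of_forall fun x => ?_)
    by_cases hx : x ∈ VBundle.supp s
    · exact pairing_congr rfl (heq x hx).self_of_nhds
    · have h0 : P s x = 0 := VBundle.eq_zero_of_notMem_supp fun h => hx (P.supp_subset s h)
      simp only [pairing_eq_zero_of_left h0]
  have h₂ : contraction μ (Pt ξ') s = contraction μ (Pt ξ) s := by
    refine integral_congr_ae (.of_forall fun x => ?_)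
    by_cases hx : x ∈ VBundle.supp s
    · exact pairing_congr (Pt.apply_eq_of_eventuallyEq (heq x hx)) rfl
    · simp only [pairing_eq_zero_of_right (VBundle.eq_zero_of_notMem_supp hx)]
  rw [← h₁, ← h₂, h s hs ξ' hξ']

theorem contraction_adjoint_of_right {P : DiffOp X Y.dual} {Pt : DiffOp Y X.dual}
    (h : ∀ s ∈ Γ₀ X, ∀ ξ ∈ Γ₀ Y, contraction μ (P s) ξ = contraction μ (Pt ξ) s)
    (s : X.Γ) {ξ : Y.Γ} (hξ : ξ ∈ Γ₀ Y) : contraction μ (P s) ξ = contraction μ (Pt ξ) s :=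
  (contraction_adjoint_of_left (fun ξ hξ s hs => (h s hs ξ hξ).symm) hξ s).symm

/-- Only the germ of `s` along the compact support of `α` enters either side, so `s` may be cut off
there. -/
theorem IsFormalAdjoint.contraction_eq {P : DiffOp X Y} {Pt : DiffOp Y.dual X.dual}
    (h : IsFormalAdjoint μ P Pt) {α : Y.dual.Γ} (hα : α ∈ Γ₀ Y.dual) (s : X.Γ) :
    contraction μ α (P s) = contraction μ (Pt α) s := by
  obtain ⟨s', hs', heq⟩ := VBundle.exists_compactSection_eventuallyEq hα s
  have h₁ : contraction μ α (P s') = contraction μ α (P s) := by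
    refine integral_congr_ae (.of_forall fun x => ?_)
    by_cases hx : x ∈ VBundle.supp α
    · exact pairing_congr rfl (P.apply_eq_of_eventuallyEq (heq x hx))
    · simp only [pairing_eq_zero_of_left (VBundle.eq_zero_of_notMem_supp hx)]
  have h₂ : contraction μ (Pt α) s' = contraction μ (Pt α) s := by
    refine integral_congr_ae (.of_forall fun x => ?_)
    by_cases hx : x ∈ VBundle.supp α
    · exact pairing_congr rfl (heq x hx).self_of_nhds
    · have h0 : Pt α x = 0 := VBundle.eq_zero_of_notMem_supp fun h => hx (Pt.supp_subset α h)
      simp only [pairing_eq_zero_of_left h0]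
  rw [← h₁, ← h₂, h α hα s' hs']

end FormalAdjoints

/-! ### Repercussions, fluctuations and reciprocity -/

section Reciprocity

variable {d : ℕ} {M : Type u} [TopologicalSpace M] [ChartedSpace (EuclideanSpace ℝ (Fin d)) M]
  [T2Space M] [IsManifold (𝓡 d) ∞ M] [MeasurableSpace M]
  {W D F H : VBundle.{u, v, w} d M} {μ : Measure M} {𝒯 : FieldEquations μ W D}
  {time : M → ℝ} {V : W.Γ → DiffOp D W} {Vt : W.Γ → DiffOp W.dual D.dual} {σ : Dir}
  {A : CompactFunctional 𝒯} {φ : W.Γ}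

/-- Gauge invariance is the vanishing of `δA ∘ R`. The distributional half of exactness for the pair
`R`, `J` then factors `δA` through `J`. -/
theorem GaugeGenerators.IsObservable.exists_isRepercussion {𝒢 : GaugeGenerators 𝒯 F H}
    (hA : 𝒢.IsObservable A) (h𝒢 : 𝒢.IsAcyclic time) (htime : Continuous time) (σ : Dir) :
    ∃ ζ, IsRepercussion 𝒯 time σ A ζ := by
  -- The factor is chosen separately for each field, no regularity in `φ` being demanded. Off shell
  -- it is set to `0`.
  have : ∀ φ : W.Γ, ∃ e : Distr D.dual, φ ∈ 𝒯.shell →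
      e.IsCausal time σ ∧ ∀ s : Γ₀ W, A.δ φ (s : W.Γ) = e ((𝒯.J φ).onCompact s) := by
    intro φ
    by_cases hφ : φ ∈ 𝒯.shell
    · obtain ⟨e, he, heq⟩ := ((h𝒢 σ φ hφ).1.2 _
        ((A.isCompactDistr φ hφ.1).isCausal htime σ)).1
        (LinearMap.ext fun ε => hA φ hφ ε ε.2)
      exact ⟨e, fun _ => ⟨he, fun s => (LinearMap.congr_fun heq s).symm⟩⟩
    · exact ⟨0, fun h => absurd h hφ⟩
  choose ζ hζ using this
  exact ⟨ζ, hζ⟩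

theorem IsRepercussion.exists_sub_eq {𝒢 : GaugeGenerators 𝒯 F H} (h𝒢 : 𝒢.IsAcyclic time)
    {ζ ζ' : W.Γ → Distr D.dual} (hζ : IsRepercussion 𝒯 time σ A ζ)
    (hζ' : IsRepercussion 𝒯 time σ A ζ') (hφ : φ ∈ 𝒯.shell) :
    ∃ m : Distr H.dual, m.IsCausal time σ ∧ ζ' φ - ζ φ = m ∘ₗ (𝒢.L φ).onCompact := by
  obtain ⟨m, hm, heq⟩ := ((h𝒢 σ φ hφ).2.1.2 _ ((hζ' φ hφ).1.sub (hζ φ hφ).1)).1 (by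
    ext s
    change ζ' φ _ - ζ φ _ = 0
    rw [← (hζ φ hφ).2, ← (hζ' φ hφ).2, sub_self])
  exact ⟨m, hm, heq.symm⟩

/-- The anchor identity moves the anchor across the Jacobi operator: `ζ (V* J* ξ) = ζ (J V ξ) = δA
(V ξ)`. -/
theorem IsRepercussion.isFluctuation_anchored (hV : IsLagrangeAnchor 𝒯 V Vt)
    {ζ : W.Γ → Distr D.dual} (hζ : IsRepercussion 𝒯 time σ A ζ) :
    IsFluctuation 𝒯 V time σ A (anchored Vt ζ) := by
  refine fun φ hφ => ⟨(hζ φ hφ).1.comp _, fun ξ => ?_⟩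
  have h := (hζ φ hφ).2 ((V φ).onCompact ξ)
  rw [DiffOp.coe_onCompact] at h
  rw [h]
  change ζ φ _ = ζ φ _
  congr 1
  exact Subtype.ext (hV.comm φ hφ ξ).symm

variable [SecondCountableTopology M]

/-- Opposite causal supports meet in a compact set, so the defining equation extends to noncompact
`ξ` on the other side. -/
theorem IsFluctuation.apply_eq {q : W.Γ → Distr W.dual} (hq : IsFluctuation 𝒯 V time σ A q)
    (hφ : φ ∈ 𝒯.shell) {ξ : D.Γ} (hξ : CausalSupport time σ.opp (VBundle.supp ξ))
    {β : Γ₀ W.dual} (hβ : 𝒯.Jt φ ξ = β) : q φ β = A.δ φ (V φ ξ) :=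
  Distr.apply_eq_of_comp_eq (A.isCompactDistr φ hφ.1) (hq φ hφ).2 hβ
    ((hq φ hφ).1.2.isCompact_inter hξ (VBundle.isClosed_supp ξ))

/-- Invariance is assumed for compactly supported parameters only. As `δA` has compact support, a
cutoff extends it to the causal parameters that exactness produces. -/
theorem GaugeGenerators.IsObservable.apply_eq_zero {𝒢 : GaugeGenerators 𝒯 F H}
    (hA : 𝒢.IsObservable A) (hφ : φ ∈ 𝒯.shell) (ε : F.Γ) : A.δ φ (𝒢.R φ ε) = 0 := by
  obtain ⟨K, hK, h⟩ := (A.isCompactDistr φ hφ.1).exists_isCompact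
  obtain ⟨ε', hε', heq⟩ := VBundle.exists_compactSection_eventuallyEq hK ε
  rw [← hA φ hφ ε' hε']
  refine h _ _ fun x hx => ?_
  filter_upwards [(heq x hx).eventually_nhds] with y hy
  exact ((𝒢.R φ).apply_eq_of_eventuallyEq hy).symm

variable [BorelSpace M] [IsLocallyFiniteMeasure μ] {B : RegularFunctional 𝒯}

theorem isRepercussion_ofSmooth (φ : W.Γ) (hφ : φ ∈ 𝒯.shell) {ξ : D.Γ}
    (hξ : 𝒯.Jt φ ξ = B.grad φ) (s : Γ₀ W) :
    B.δ φ (s : W.Γ) = ofSmooth μ ξ ((𝒯.J φ).onCompact s) := by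
  rw [B.δ_eq φ hφ.1, ofSmooth_apply, DiffOp.coe_onCompact,
    contraction_adjoint_of_left (𝒯.adjoint φ hφ.1) s.2, hξ]

variable [μ.IsOpenPosMeasure]

theorem FieldEquations.Jt_eq_zero (𝒯 : FieldEquations μ W D) (hφ : φ ∈ 𝒯.shell) {ξ : D.Γ}
    (h : ∀ s ∈ Γ₀ W, contraction μ (𝒯.J φ s) ξ = 0) : 𝒯.Jt φ ξ = 0 :=
  eq_zero_of_contraction_eq_zero (μ := μ) fun s hs => by
    rw [← contraction_adjoint_of_left (𝒯.adjoint φ hφ.1) hs, h s hs]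

theorem FieldEquations.J_eq_zero (𝒯 : FieldEquations μ W D) (hφ : φ ∈ 𝒯.shell) {s : W.Γ}
    (h : ∀ ξ ∈ Γ₀ D, contraction μ (𝒯.Jt φ ξ) s = 0) : 𝒯.J φ s = 0 :=
  eq_zero_of_contraction_eq_zero (μ := μ) fun ξ hξ => by
    rw [contraction_adjoint_of_right (𝒯.adjoint φ hφ.1) s hξ, h ξ hξ]

/-- Gauge invariance of `B` reads `R* (grad B) = 0`, and the compact gradient is causal on either
side. Exactness at `W*` thus provides a smooth `ξ` on whichever side is wanted. -/
theorem GaugeGenerators.IsObservable.exists_Jt_eq_grad {𝒢 : GaugeGenerators 𝒯 F H}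
    (hB : 𝒢.IsObservable B.toCompactFunctional) (h𝒢 : 𝒢.IsAcyclic time) (htime : Continuous time)
    (σ : Dir) (hφ : φ ∈ 𝒯.shell) :
    ∃ ξ : D.Γ, CausalSupport time σ (VBundle.supp ξ) ∧ 𝒯.Jt φ ξ = B.grad φ := by
  refine ((h𝒢 σ φ hφ).2.2.2.1 _ (IsCompact.causalSupport htime (B.grad φ).2 σ)).1 ?_
  refine eq_zero_of_contraction_eq_zero (μ := μ) fun ε hε => ?_
  rw [← 𝒢.R_adjoint φ hφ.1 _ (B.grad φ).2 ε hε, ← B.δ_eq φ hφ.1]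
  exact hB φ hφ ε hε

theorem GaugeGenerators.IsObservable.exists_smooth_isRepercussion {𝒢 : GaugeGenerators 𝒯 F H}
    (hB : 𝒢.IsObservable B.toCompactFunctional) (h𝒢 : 𝒢.IsAcyclic time) (htime : Continuous time)
    (σ : Dir) :
    ∃ ξ : W.Γ → D.Γ, IsRepercussion 𝒯 time σ B.toCompactFunctional fun φ => ofSmooth μ (ξ φ) := by
  have : ∀ φ : W.Γ, ∃ ξ : D.Γ, φ ∈ 𝒯.shell →
      CausalSupport time σ (VBundle.supp ξ) ∧ 𝒯.Jt φ ξ = B.grad φ := by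
    intro φ
    by_cases hφ : φ ∈ 𝒯.shell
    · obtain ⟨ξ, hξ⟩ := hB.exists_Jt_eq_grad h𝒢 htime σ hφ
      exact ⟨ξ, fun _ => hξ⟩
    · exact ⟨0, fun h => absurd h hφ⟩
  choose ξ hξ using this
  exact ⟨ξ, fun φ hφ => ⟨ofSmooth_isCausal (hξ φ hφ).1,
    isRepercussion_ofSmooth φ hφ (hξ φ hφ).2⟩⟩

theorem IsRepercussion.exists_smooth_sub_eq {𝒢 : GaugeGenerators 𝒯 F H} (h𝒢 : 𝒢.IsAcyclic time)
    {ξ ξ' : W.Γ → D.Γ} (hξ : IsRepercussion 𝒯 time σ A fun φ => ofSmooth μ (ξ φ))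
    (hξ' : IsRepercussion 𝒯 time σ A fun φ => ofSmooth μ (ξ' φ)) (hφ : φ ∈ 𝒯.shell) :
    ∃ m : H.Γ, CausalSupport time σ (VBundle.supp m) ∧ ξ' φ - ξ φ = 𝒢.Lt φ m := by
  have hc : (ofSmooth μ (ξ' φ - ξ φ)).IsCausal time σ := by
    rw [ofSmooth_sub]
    exact (hξ' φ hφ).1.sub (hξ φ hφ).1
  obtain ⟨m, hm, heq⟩ := ((h𝒢 σ φ hφ).2.2.1.1 _ (ofSmooth_isCausal_iff.1 hc)).1 (by
    refine 𝒯.Jt_eq_zero hφ fun s hs => ?_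
    change ofSmooth μ (ξ' φ - ξ φ) ((𝒯.J φ).onCompact ⟨s, hs⟩) = 0
    rw [ofSmooth_sub, LinearMap.sub_apply, ← (hξ φ hφ).2, ← (hξ' φ hφ).2, sub_self])
  exact ⟨m, hm, heq.symm⟩

theorem IsRepercussion.isFluctuation_ofSmooth (hV : IsLagrangeAnchor 𝒯 V Vt) {ξ : W.Γ → D.Γ}
    (hξ : IsRepercussion 𝒯 time σ A fun φ => ofSmooth μ (ξ φ)) :
    IsFluctuation 𝒯 V time σ A fun φ => ofSmooth μ (V φ (ξ φ)) := by
  refine fun φ hφ => ⟨ofSmooth_isCausal ?_, fun η => ?_⟩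
  · exact (ofSmooth_isCausal_iff.1 (hξ φ hφ).1).mono (VBundle.isClosed_supp _)
      ((V φ).supp_subset _)
  · have h := (hξ φ hφ).2 ((V φ).onCompact η)
    rw [DiffOp.coe_onCompact] at h
    rw [h, ofSmooth_apply, ofSmooth_apply, DiffOp.coe_onCompact, DiffOp.coe_onCompact,
      DiffOp.coe_onCompact, hV.comm φ hφ,
      (hV.adjoint φ hφ.1).contraction_eq ((𝒯.Jt φ).mem_compactSections η.2)]

/-- The reciprocity relation between an advanced and a retarded fluctuation. -/
theorem reciprocity {𝒢 : GaugeGenerators 𝒯 F H} (hV : IsLagrangeAnchor 𝒯 V Vt)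
    (h𝒢 : 𝒢.IsAcyclic time) (htime : Continuous time) (hA : 𝒢.IsObservable A)
    (hB : 𝒢.IsObservable B.toCompactFunctional) {q : W.Γ → Distr W.dual} {s : W.Γ → W.Γ}
    (hq : IsFluctuation 𝒯 V time σ A q)
    (hs : IsFluctuation 𝒯 V time σ.opp B.toCompactFunctional fun φ => ofSmooth μ (s φ)) :
    𝒯.OnShellEq (distrAct q B) (smoothAct s A) := by
  intro φ hφ
  obtain ⟨ξ, hξc, hξ⟩ := hB.exists_Jt_eq_grad h𝒢 htime σ.opp hφ
  change q φ (B.grad φ) = A.δ φ (s φ)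
  rw [hq.apply_eq hφ hξc hξ]
  have hc : (ofSmooth μ (V φ ξ)).IsCausal time σ.opp :=
    ofSmooth_isCausal (hξc.mono (VBundle.isClosed_supp _) ((V φ).supp_subset _))
  -- Both `V ξ` and `s` are fluctuations of `B` on the same side, so their difference lies in the
  -- kernel of `J` and is a gauge variation.
  obtain ⟨ε, -, hε⟩ := ((h𝒢 σ.opp φ hφ).1.1 (V φ ξ - s φ) (ofSmooth_isCausal_iff (μ := μ).1 (by
    rw [ofSmooth_sub]
    exact hc.sub (hs φ hφ).1))).1 (by
      refine 𝒯.J_eq_zero hφ fun η hη => ?_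
      change ofSmooth μ (V φ ξ - s φ) ((𝒯.Jt φ).onCompact ⟨η, hη⟩) = 0
      -- In terms of contractions: `⟨J* η, V ξ⟩ = ⟨V* J* η, ξ⟩ = ⟨J V η, ξ⟩ = ⟨J* ξ, V η⟩ = δB (V
      -- η)`.
      rw [ofSmooth_sub, LinearMap.sub_apply, (hs φ hφ).2, sub_eq_zero, ofSmooth_apply,
        DiffOp.coe_onCompact,
        (hV.adjoint φ hφ.1).contraction_eq ((𝒯.Jt φ).mem_compactSections hη), ← hV.comm φ hφ η,
        contraction_adjoint_of_left (𝒯.adjoint φ hφ.1) ((V φ).mem_compactSections hη), hξ,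
        ← B.δ_eq φ hφ.1])
  rw [← sub_eq_zero, ← map_sub, ← hε]
  exact hA.apply_eq_zero hφ ε

end Reciprocity

/-! ### Differentiation under the integral over the space-time -/

section ParametricIntegrals

variable {d : ℕ} {M : Type u} [TopologicalSpace M] [ChartedSpace (EuclideanSpace ℝ (Fin d)) M]
  {p : ℕ} {O : Set (EuclideanSpace ℝ (Fin p))}
  {g : EuclideanSpace ℝ (Fin p) × M → ℝ}

theorem ContMDiffOn.differentiableAt_left (hO : IsOpen O)
    (hg : ContMDiffOn ((𝓡 p).prod (𝓡 d)) 𝓘(ℝ, ℝ) ∞ g (O ×ˢ univ))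
    {s : EuclideanSpace ℝ (Fin p)} (hs : s ∈ O) (x : M) :
    DifferentiableAt ℝ (fun s => g (s, x)) s := by
  have hgq : ContMDiffAt ((𝓡 p).prod (𝓡 d)) 𝓘(ℝ, ℝ) ∞ g (s, x) :=
    hg.contMDiffAt ((hO.prod isOpen_univ).mem_nhds ⟨hs, mem_univ x⟩)
  have h : ContMDiffAt (𝓡 p) 𝓘(ℝ, ℝ) ∞ (fun s => g (s, x)) s :=
    ContMDiffAt.comp s (I' := (𝓡 p).prod (𝓡 d)) hgq (contMDiffAt_id.prodMk contMDiffAt_const)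
  exact h.contDiffAt.differentiableAt (by simp)

theorem ContMDiffOn.continuous_right
    (hg : ContMDiffOn ((𝓡 p).prod (𝓡 d)) 𝓘(ℝ, ℝ) ∞ g (O ×ˢ univ))
    {s : EuclideanSpace ℝ (Fin p)} (hs : s ∈ O) : Continuous fun x => g (s, x) :=
  hg.continuousOn.comp_continuous (by fun_prop) fun x => ⟨hs, mem_univ x⟩

variable [IsManifold (𝓡 d) ∞ M]

theorem ContMDiffOn.continuousOn_fderiv_left (hO : IsOpen O)
    (hg : ContMDiffOn ((𝓡 p).prod (𝓡 d)) 𝓘(ℝ, ℝ) ∞ g (O ×ˢ univ)) :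
    ContinuousOn (fun q : EuclideanSpace ℝ (Fin p) × M => fderiv ℝ (fun s => g (s, q.2)) q.1)
      (O ×ˢ univ) := by
  rintro ⟨s, x⟩ hq
  refine ContinuousAt.continuousWithinAt ?_
  have hgq : ContMDiffAt ((𝓡 p).prod (𝓡 d)) 𝓘(ℝ, ℝ) ∞ g (s, x) :=
    hg.contMDiffAt ((hO.prod isOpen_univ).mem_nhds hq)
  have h := ContMDiffAt.mfderiv (J := (𝓡 p).prod (𝓡 d)) (I := 𝓡 p) (I' := 𝓘(ℝ, ℝ)) (m := 0)
    (n := ∞) (x₀ := (s, x)) (fun (q : EuclideanSpace ℝ (Fin p) × M) s' => g (s', q.2)) Prod.fst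
    (ContMDiffAt.comp (I' := (𝓡 p).prod (𝓡 d)) ((s, x), s) (g := g)
      (f := fun r : (EuclideanSpace ℝ (Fin p) × M) × EuclideanSpace ℝ (Fin p) => (r.2, r.1.2)) hgq
      (contMDiffAt_snd.prodMk (contMDiffAt_snd.comp _ contMDiffAt_fst))) contMDiffAt_fst (by simp)
  -- The parameter and target spaces are vector spaces, so the derivative in tangent coordinates is
  -- the plain Fréchet derivative.
  have h' := (inTangentCoordinates_model_space (I := 𝓡 p) (I' := 𝓘(ℝ, ℝ))
    (Prod.fst : EuclideanSpace ℝ (Fin p) × M → _) (fun q => g (q.1, q.2))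
    (fun q => mfderiv (𝓡 p) 𝓘(ℝ, ℝ) (fun s' => g (s', q.2)) q.1) (s, x)).symm
  simpa only [mfderiv_eq_fderiv] using (h.congr_of_eventuallyEq (.of_eq h')).continuousAt

variable [T2Space M] [MeasurableSpace M] [BorelSpace M]
  {μ : Measure M} [IsLocallyFiniteMeasure μ] {K : Set M} {s₀ : EuclideanSpace ℝ (Fin p)}

theorem ContMDiffOn.integrable_fderiv_left (hO : IsOpen O)
    (hg : ContMDiffOn ((𝓡 p).prod (𝓡 d)) 𝓘(ℝ, ℝ) ∞ g (O ×ˢ univ)) (hK : IsCompact K)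
    (h0 : ∀ s ∈ O, ∀ x ∉ K, g (s, x) = 0) (hs₀ : s₀ ∈ O) :
    Integrable (fun x => fderiv ℝ (fun s => g (s, x)) s₀) μ := by
  have hcont : Continuous fun x => fderiv ℝ (fun s => g (s, x)) s₀ :=
    (hg.continuousOn_fderiv_left hO).comp_continuous (f := fun x => (s₀, x)) (by fun_prop)
      fun x => ⟨hs₀, mem_univ x⟩
  refine hcont.integrable_of_hasCompactSupport (HasCompactSupport.intro hK fun x hx => ?_)
  have : (fun s => g (s, x)) =ᶠ[𝓝 s₀] fun _ => 0 := by
    filter_upwards [hO.mem_nhds hs₀] with s hs using h0 s hs x hx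
  rw [this.fderiv_eq, fderiv_const_apply]

theorem ContMDiffOn.hasFDerivAt_integral (hO : IsOpen O)
    (hg : ContMDiffOn ((𝓡 p).prod (𝓡 d)) 𝓘(ℝ, ℝ) ∞ g (O ×ˢ univ)) (hK : IsCompact K)
    (h0 : ∀ s ∈ O, ∀ x ∉ K, g (s, x) = 0) (hs₀ : s₀ ∈ O) :
    HasFDerivAt (fun s => ∫ x, g (s, x) ∂μ) (∫ x, fderiv ℝ (fun s => g (s, x)) s₀ ∂μ) s₀ := by
  obtain ⟨r, hr, hrO⟩ := Metric.nhds_basis_closedBall.mem_iff.1 (hO.mem_nhds hs₀)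
  -- The dominating function is `C` on `K` and `0` elsewhere, with `C` a bound for the jointly
  -- continuous derivative on the compact set `closedBall s₀ r ×ˢ K`.
  obtain ⟨C, hC⟩ := ((isCompact_closedBall s₀ r).prod hK).exists_bound_of_continuousOn
    ((hg.continuousOn_fderiv_left hO).mono (prod_mono hrO (subset_univ K)))
  refine hasFDerivAt_integral_of_dominated_of_fderiv_le (s := Metric.closedBall s₀ r)
    (F := fun s x => g (s, x)) (F' := fun s x => fderiv ℝ (fun s => g (s, x)) s)
    (bound := K.indicator fun _ => C)
    (Metric.closedBall_mem_nhds s₀ hr) ?_ ?_ ?_ ?_ ?_ ?_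
  · filter_upwards [hO.mem_nhds hs₀] with s hs
    exact (hg.continuous_right hs).aestronglyMeasurable
  · exact (hg.continuous_right hs₀).integrable_of_hasCompactSupport
      (HasCompactSupport.intro hK fun x hx => h0 s₀ hs₀ x hx)
  · exact (hg.integrable_fderiv_left hO hK h0 hs₀).aestronglyMeasurable
  · refine .of_forall fun x s hs => ?_
    by_cases hx : x ∈ K
    · rw [indicator_of_mem hx]
      exact hC (s, x) ⟨hs, hx⟩
    · have : (fun s => g (s, x)) =ᶠ[𝓝 s] fun _ => 0 := by
        filter_upwards [hO.mem_nhds (hrO hs)] with s hs using h0 s hs x hx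
      rw [this.fderiv_eq, fderiv_const_apply, norm_zero, indicator_of_notMem hx]
  · exact (integrable_indicator_iff hK.measurableSet).2 (integrableOn_const hK.measure_lt_top.ne)
  · exact .of_forall fun x s hs => (hg.differentiableAt_left hO (hrO hs) x).hasFDerivAt

end ParametricIntegrals

/-! ### Finite-dimensional affine families of fields -/

section Families

variable {d : ℕ} {M : Type u} [TopologicalSpace M] [ChartedSpace (EuclideanSpace ℝ (Fin d)) M]
  {W : VBundle.{u, v, w} d M} {p : ℕ}

/-- The affine family of sections through `φ` with directions `s i`. -/
noncomputable def affineFamily (φ : W.Γ) (s : Fin p → W.Γ) (q : EuclideanSpace ℝ (Fin p)) : W.Γ :=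
  φ + ∑ i, q i • s i

theorem affineFamily_apply (φ : W.Γ) (s : Fin p → W.Γ) (q : EuclideanSpace ℝ (Fin p)) (x : M) :
    affineFamily φ s q x = φ x + ∑ i, q i • s i x := by
  have h := map_sum (ContMDiffSection.coeAddHom (𝓡 d) W.F ∞ W.V) (fun i => q i • s i) Finset.univ
  have h' := congrFun h x
  rw [Finset.sum_apply] at h'
  change φ x + (∑ i, q i • s i : W.Γ) x = _
  exact congrArg (φ x + ·) h'

theorem affineFamily_zero (φ : W.Γ) (s : Fin p → W.Γ) : affineFamily φ s 0 = φ := by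
  simp [affineFamily]

theorem affineFamily_add_single (φ : W.Γ) (s : Fin p → W.Γ) (q : EuclideanSpace ℝ (Fin p))
    (i : Fin p) (ε : ℝ) :
    affineFamily φ s (q + ε • EuclideanSpace.single i 1) = affineFamily φ s q + ε • s i := by
  simp [affineFamily, add_smul, Finset.sum_add_distrib, add_assoc]

theorem affineFamily_contMDiff (φ : W.Γ) (s : Fin p → W.Γ) :
    ContMDiff ((𝓡 p).prod (𝓡 d)) ((𝓡 d).prod 𝓘(ℝ, W.F)) ∞
      (fun q : EuclideanSpace ℝ (Fin p) × M => TotalSpace.mk' W.F q.2 (affineFamily φ s q.1 q.2)) := by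
  rintro ⟨q₀, x₀⟩
  rw [contMDiffAt_totalSpace]
  refine ⟨contMDiffAt_snd, ?_⟩
  set e := trivializationAt W.F W.V x₀
  have key : ∀ t : W.Γ, ContMDiffAt ((𝓡 p).prod (𝓡 d)) 𝓘(ℝ, W.F) ∞
      (fun q : EuclideanSpace ℝ (Fin p) × M => (e ⟨q.2, t q.2⟩).2) (q₀, x₀) := fun t =>
    ContMDiffAt.comp (q₀, x₀) (I' := 𝓡 d) (g := fun x => (e ⟨x, t x⟩).2)
      (contMDiffAt_totalSpace.1 (t.contMDiff x₀)).2 contMDiffAt_snd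
  have hcoord : ∀ i, ContMDiffAt ((𝓡 p).prod (𝓡 d)) 𝓘(ℝ, ℝ) ∞
      (fun q : EuclideanSpace ℝ (Fin p) × M => q.1 i) (q₀, x₀) := fun i =>
    ContMDiffAt.comp (q₀, x₀) (I' := 𝓡 p)
      (EuclideanSpace.proj (𝕜 := ℝ) i).contMDiff.contMDiffAt contMDiffAt_fst
  have hsum : ContMDiffAt ((𝓡 p).prod (𝓡 d)) 𝓘(ℝ, W.F) ∞
      (fun q : EuclideanSpace ℝ (Fin p) × M =>
        (e ⟨q.2, φ q.2⟩).2 + ∑ i, q.1 i • (e ⟨q.2, s i q.2⟩).2) (q₀, x₀) :=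
    (key φ).add (contMDiffAt_finsetSum fun i _ => (hcoord i).smul (key (s i)))
  refine hsum.congr_of_eventuallyEq ?_
  have hb : ∀ᶠ q : EuclideanSpace ℝ (Fin p) × M in 𝓝 (q₀, x₀), q.2 ∈ e.baseSet :=
    continuousAt_snd.eventually_mem
      (e.open_baseSet.mem_nhds (FiberBundle.mem_baseSet_trivializationAt' x₀))
  filter_upwards [hb] with q hq
  -- Over the base set the trivialization is fibrewise linear, so it commutes with the linear
  -- combination defining the family.
  have hl : ∀ z : W.V q.2, (e ⟨q.2, z⟩).2 = e.linearMapAt ℝ q.2 z := fun z => by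
    rw [e.coe_linearMapAt_of_mem hq]
  simp only [hl, affineFamily_apply, map_add, map_sum, map_smul]

theorem IsLocalOfOrder.contMDiffOn_affineFamily {U : Set (TotalSpace W.F W.V)} {k : ℕ}
    {f : W.Γ → M → ℝ} (hf : IsLocalOfOrder U k f) {φ : W.Γ} {s : Fin p → W.Γ}
    {O : Set (EuclideanSpace ℝ (Fin p))} (hO : IsOpen O)
    (hOU : ∀ q ∈ O, affineFamily φ s q ∈ Configurations U) :
    ContMDiffOn ((𝓡 p).prod (𝓡 d)) 𝓘(ℝ, ℝ) ∞
      (fun q : EuclideanSpace ℝ (Fin p) × M => f (affineFamily φ s q.1) q.2) (O ×ˢ univ) :=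
  hf.2 p O _ hO hOU (affineFamily_contMDiff φ s).contMDiffOn

/-- The family differs from `φ` only over a compact set, where the tube lemma gives one parameter
neighbourhood valid at all points. -/
theorem exists_isOpen_affineFamily_mem [T2Space M] {U : Set (TotalSpace W.F W.V)} (hU : IsOpen U)
    {φ : W.Γ} (hφ : φ ∈ Configurations U) {s : Fin p → W.Γ} (hs : ∀ i, s i ∈ Γ₀ W) :
    ∃ O : Set (EuclideanSpace ℝ (Fin p)), IsOpen O ∧ 0 ∈ O ∧
      ∀ q ∈ O, affineFamily φ s q ∈ Configurations U := by
  have hK : IsCompact (⋃ i, VBundle.supp (s i)) := isCompact_iUnion hs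
  have hopen : IsOpen ((fun q : EuclideanSpace ℝ (Fin p) × M =>
      TotalSpace.mk' W.F q.2 (affineFamily φ s q.1 q.2)) ⁻¹' U) :=
    hU.preimage (affineFamily_contMDiff φ s).continuous
  obtain ⟨O, O', hO, -, h0, hKO', hsub⟩ := generalized_tube_lemma (isCompact_singleton (x := 0)) hK
    hopen (by
      rintro ⟨q, x⟩ ⟨rfl, -⟩
      change TotalSpace.mk' W.F x (affineFamily φ s 0 x) ∈ U
      rw [affineFamily_zero]
      exact hφ x)
  refine ⟨O, hO, h0 rfl, fun q hq x => ?_⟩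
  by_cases hx : x ∈ ⋃ i, VBundle.supp (s i)
  · exact hsub (mk_mem_prod hq (hKO' hx))
  · rw [affineFamily_apply, Finset.sum_eq_zero, add_zero]
    · exact hφ x
    · intro i _
      rw [VBundle.eq_zero_of_notMem_supp fun h => hx (mem_iUnion.2 ⟨i, h⟩), smul_zero]

theorem affineFamily_eventuallyEq {φ : W.Γ} {s : Fin p → W.Γ} {x : M}
    (hx : x ∉ ⋃ i, VBundle.supp (s i)) (q : EuclideanSpace ℝ (Fin p)) :
    ∀ᶠ y in 𝓝 x, affineFamily φ s q y = φ y := by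
  have : ∀ i, ∀ᶠ y in 𝓝 x, s i y = 0 := fun i =>
    VBundle.eventually_eq_zero_of_notMem_supp fun h => hx (mem_iUnion.2 ⟨i, h⟩)
  filter_upwards [Filter.eventually_all.2 this] with y hy
  rw [affineFamily_apply, Finset.sum_eq_zero fun i _ => by rw [hy i, smul_zero], add_zero]

end Families

/-! ### Lagrangian equations: self-adjointness of the Jacobi operator -/

section Lagrangian

variable {d : ℕ} {M : Type u} [TopologicalSpace M] [ChartedSpace (EuclideanSpace ℝ (Fin d)) M]
  [T2Space M] [IsManifold (𝓡 d) ∞ M] [MeasurableSpace M] [BorelSpace M]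
  {W D : VBundle.{u, v, w} d M} {μ : Measure M} [IsLocallyFiniteMeasure μ] {p : ℕ}

/-- The derivative of the contraction of the field equations with a test section along an affine
family of field configurations. -/
theorem FieldEquations.exists_hasFDerivAt_contraction (𝒯 : FieldEquations μ W D) {φ : W.Γ}
    (hφ : φ ∈ Configurations 𝒯.U) {s : Fin p → W.Γ} (hs : ∀ i, s i ∈ Γ₀ W) {ξ : D.Γ}
    (hξ : ξ ∈ Γ₀ D) :
    ∃ L : EuclideanSpace ℝ (Fin p) →L[ℝ] ℝ,
      HasFDerivAt (fun q => contraction μ (𝒯.T (affineFamily φ s q)) ξ) L 0 ∧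
      ∀ i, L (EuclideanSpace.single i 1) = contraction μ (𝒯.J φ (s i)) ξ := by
  obtain ⟨O, hO, h0, hOU⟩ := exists_isOpen_affineFamily_mem 𝒯.isOpen_U hφ hs
  obtain ⟨k, hk⟩ := 𝒯.isLocal_T
  have hg := (hk ξ).contMDiffOn_affineFamily hO hOU
  have hz : ∀ q ∈ O, ∀ x ∉ VBundle.supp ξ, pairing (𝒯.T (affineFamily φ s q)) ξ x = 0 :=
    fun q _ x hx => pairing_eq_zero_of_right (VBundle.eq_zero_of_notMem_supp hx) _
  refine ⟨_, hg.hasFDerivAt_integral (μ := μ) hO hξ hz h0, fun i => ?_⟩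
  rw [ContinuousLinearMap.integral_apply (hg.integrable_fderiv_left hO hξ hz h0)]
  refine integral_congr_ae (.of_forall fun x => ?_)
  -- The linearization is known pointwise and along lines only. Smoothness of the family supplies
  -- the Fréchet derivative, whose values on basis vectors these lines determine.
  have h1 := 𝒯.linearization φ hφ (s i) (hs i) ξ x
  have h2 := (hg.differentiableAt_left hO h0 x).hasFDerivAt
  have h3 : HasDerivAt (fun ε : ℝ => (0 : EuclideanSpace ℝ (Fin p)) + ε • EuclideanSpace.single i 1)
      (EuclideanSpace.single i 1) 0 := by
    simpa using ((hasDerivAt_id (0 : ℝ)).smul_const (EuclideanSpace.single i (1 : ℝ))).const_add 0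
  have h4 := h2.comp_hasDerivAt_of_eq (0 : ℝ) h3 (by simp)
  refine h4.unique (h1.congr_of_eventuallyEq (.of_forall fun ε => ?_))
  change pairing (𝒯.T (affineFamily φ s (0 + ε • EuclideanSpace.single i 1))) ξ x = _
  rw [affineFamily_add_single, affineFamily_zero]

/-- Both sides are the mixed second derivative at `0` of the action along `φ + q₀ s + q₁ t`, in the
two orders of differentiation. -/
theorem FieldEquations.IsLagrangian.contraction_J_comm {𝒯 : FieldEquations μ W W}
    (h𝒯 : 𝒯.IsLagrangian) {φ : W.Γ} (hφ : φ ∈ Configurations 𝒯.U) {s t : W.Γ} (hs : s ∈ Γ₀ W)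
    (ht : t ∈ Γ₀ W) : contraction μ (𝒯.J φ s) t = contraction μ (𝒯.J φ t) s := by
  obtain ⟨ℓ, k, hℓ, hS⟩ := h𝒯
  let e : Fin 2 → W.Γ := ![s, t]
  have he : ∀ i, e i ∈ Γ₀ W := by
    intro i
    fin_cases i
    exacts [hs, ht]
  obtain ⟨O, hO, h0, hOU⟩ := exists_isOpen_affineFamily_mem 𝒯.isOpen_U hφ he
  have hK : IsCompact (⋃ i, VBundle.supp (e i)) := isCompact_iUnion he
  -- The action itself may diverge. Off the supports of the variations all jets agree with those of
  -- `φ`, so the difference of Lagrangian densities has compact support and is integrable.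
  have hloc : ∀ q ∈ O, ∀ x ∉ ⋃ i, VBundle.supp (e i), ℓ (affineFamily φ e q) x = ℓ φ x :=
    fun q hq x hx => hℓ.1 _ (hOU q hq) _ hφ x
      (SameJet.of_eventuallyEq k (affineFamily_eventuallyEq hx q))
  have hℓ1 := hℓ.contMDiffOn_affineFamily hO hOU
  have hℓ0 : ContMDiffOn ((𝓡 2).prod (𝓡 d)) 𝓘(ℝ, ℝ) ∞
      (fun q : EuclideanSpace ℝ (Fin 2) × M => ℓ φ q.2) (O ×ˢ univ) := by
    have hc : ContMDiffOn ((𝓡 2).prod (𝓡 d)) ((𝓡 2).prod (𝓡 d)) ∞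
        (fun q : EuclideanSpace ℝ (Fin 2) × M => ((0 : EuclideanSpace ℝ (Fin 2)), q.2))
        (O ×ˢ univ) := contMDiffOn_const.prodMk contMDiffOn_snd
    have := hℓ1.comp hc fun q _ => mk_mem_prod h0 (mem_univ q.2)
    simpa only [Function.comp_def, affineFamily_zero] using this
  have hg := hℓ1.sub hℓ0
  have hz : ∀ q ∈ O, ∀ x ∉ ⋃ i, VBundle.supp (e i), ℓ (affineFamily φ e q) x - ℓ φ x = 0 :=
    fun q hq x hx => sub_eq_zero.2 (hloc q hq x hx)
  have hint : ∀ q ∈ O, Integrable (fun x => ℓ (affineFamily φ e q) x - ℓ φ x) μ := fun q hq =>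
    (hg.continuous_right hq).integrable_of_hasCompactSupport (HasCompactSupport.intro hK (hz q hq))
  let f : EuclideanSpace ℝ (Fin 2) → ℝ := fun q => ∫ x, (ℓ (affineFamily φ e q) x - ℓ φ x) ∂μ
  let pr : Fin 2 → EuclideanSpace ℝ (Fin 2) →L[ℝ] ℝ := fun i => EuclideanSpace.proj i
  let f' : EuclideanSpace ℝ (Fin 2) → EuclideanSpace ℝ (Fin 2) →L[ℝ] ℝ := fun q =>
    ∑ i, contraction μ (𝒯.T (affineFamily φ e q)) (e i) • pr i
  have hf : ∀ q ∈ O, HasFDerivAt f (f' q) q := by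
    intro q hq
    have h1 : HasFDerivAt f _ q := hg.hasFDerivAt_integral (μ := μ) hO hK hz hq
    convert h1 using 1
    refine ContinuousLinearMap.coe_injective ((EuclideanSpace.basisFun (Fin 2) ℝ).toBasis.ext
      fun i => ?_)
    rw [OrthonormalBasis.coe_toBasis, EuclideanSpace.basisFun_apply]
    have h3 : HasDerivAt (fun ε : ℝ => q + ε • EuclideanSpace.single i (1 : ℝ))
        (EuclideanSpace.single i 1) 0 := by
      simpa using ((hasDerivAt_id (0 : ℝ)).smul_const (EuclideanSpace.single i (1 : ℝ))).const_add q
    have h4 := h1.comp_hasDerivAt_of_eq (0 : ℝ) h3 (by simp)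
    -- The variational formula at the displaced field uses that field as reference in the integrand.
    -- Adding the constant `f q` restores the reference `φ`.
    have h5 := (hS _ (hOU q hq) (e i) (he i)).const_add (f q)
    have hmem : ∀ᶠ ε : ℝ in 𝓝 0, q + ε • EuclideanSpace.single i (1 : ℝ) ∈ O :=
      h3.continuousAt.eventually_mem (hO.mem_nhds (by simpa using hq))
    have h6 := h4.unique (h5.congr_of_eventuallyEq (by
      filter_upwards [hmem] with ε hε
      change ∫ x, _ ∂μ = _ + ∫ x, _ ∂μ
      rw [← sub_eq_iff_eq_add', ← integral_sub (hint _ hε) (hint q hq)]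
      refine integral_congr_ae (.of_forall fun x => ?_)
      simp only [affineFamily_add_single, sub_sub_sub_cancel_right]))
    refine Eq.trans ?_ h6.symm
    fin_cases i <;> simp [f', pr]
  have hL := fun i => 𝒯.exists_hasFDerivAt_contraction (μ := μ) hφ he (he i)
  choose L hL hLe using hL
  let f'' : EuclideanSpace ℝ (Fin 2) →L[ℝ] EuclideanSpace ℝ (Fin 2) →L[ℝ] ℝ :=
    ∑ i, (L i).smulRight (pr i)
  have hf' : HasFDerivAt f' f'' 0 :=
    HasFDerivAt.fun_sum fun i _ => (hL i).smul_const (pr i)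
  have hsymm := second_derivative_symmetric_of_eventually
    (Filter.mem_of_superset (hO.mem_nhds h0) hf) hf' (EuclideanSpace.single 0 1)
    (EuclideanSpace.single 1 1)
  have h01 : f'' (EuclideanSpace.single 0 1) (EuclideanSpace.single 1 1)
      = contraction μ (𝒯.J φ s) t := by
    simp [f'', pr, hLe, e]
  have h10 : f'' (EuclideanSpace.single 1 1) (EuclideanSpace.single 0 1)
      = contraction μ (𝒯.J φ t) s := by
    simp [f'', pr, hLe, e]
  rw [← h01, ← h10, hsymm]

variable [SecondCountableTopology M] [μ.IsOpenPosMeasure]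

/-- For compactly supported `ξ` this is the symmetry of the second variation and the fundamental
lemma. Locality of both operators gives the general case. -/
theorem FieldEquations.IsLagrangian.J_eq_Jt {𝒯 : FieldEquations μ W W} (h𝒯 : 𝒯.IsLagrangian)
    {φ : W.Γ} (hφ : φ ∈ Configurations 𝒯.U) (ξ : W.Γ) : 𝒯.J φ ξ = 𝒯.Jt φ ξ := by
  have key : ∀ ξ ∈ Γ₀ W, 𝒯.J φ ξ - 𝒯.Jt φ ξ = 0 := fun ξ hξ =>
    eq_zero_of_contraction_eq_zero (μ := μ) fun s hs => by
      have h1 : contraction μ (𝒯.J φ ξ) s = contraction μ (𝒯.Jt φ ξ) s := by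
        rw [h𝒯.contraction_J_comm hφ hξ hs, 𝒯.adjoint φ hφ s hs ξ hξ]
      have h2 := integral_sub (pairing_integrable_of_right (μ := μ) (𝒯.J φ ξ) ⟨s, hs⟩)
        (pairing_integrable_of_right (𝒯.Jt φ ξ) ⟨s, hs⟩)
      exact h2.trans (sub_eq_zero.2 h1)
  ext x : 1
  obtain ⟨ξ', hξ', heq⟩ :=
    VBundle.exists_compactSection_eventuallyEq (isCompact_singleton (x := x)) ξ
  rw [← (𝒯.J φ).apply_eq_of_eventuallyEq (heq x rfl),
    ← (𝒯.Jt φ).apply_eq_of_eventuallyEq (heq x rfl), sub_eq_zero.1 (key ξ' hξ')]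

/-- Lagrangian equations have the canonical Lagrange anchor. -/
theorem FieldEquations.IsLagrangian.isLagrangeAnchor_id {𝒯 : FieldEquations μ W W}
    (h𝒯 : 𝒯.IsLagrangian) :
    IsLagrangeAnchor 𝒯 (fun _ => DiffOp.id W) (fun _ => DiffOp.id W.dual) :=
  ⟨fun _ _ _ _ _ _ => rfl, fun _ hφ ξ => h𝒯.J_eq_Jt hφ.1 ξ⟩

end Lagrangian

/-! ### Green functions and their fluctuations -/

section Green

variable {d : ℕ} {M : Type u} [TopologicalSpace M] [ChartedSpace (EuclideanSpace ℝ (Fin d)) M]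
  [T2Space M] [IsManifold (𝓡 d) ∞ M] [MeasurableSpace M]
  {W : VBundle.{u, v, w} d M} {μ : Measure M} {𝒯 : FieldEquations μ W W}
  {time : M → ℝ} {σ : Dir} {A : CompactFunctional 𝒯} {φ : W.Γ}
  {G : Dir → W.Γ → Γ₀ W.dual →ₗ[ℝ] W.Γ}

/-- The labels cross: `G^{+ij}` vanishes for `i` later than `j`, so `α ↦ G^{+ij} α_j` spreads
towards the past and has retarded support. -/
theorem IsGreen.causalSupport (hG : IsGreen 𝒯 time G) (htime : Continuous time)
    (hφ : φ ∈ 𝒯.shell) (σ : Dir) (α : Γ₀ W.dual) :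
    CausalSupport time σ.opp (VBundle.supp (G σ φ α)) := by
  obtain ⟨-, -, hs, ht⟩ := hG φ hφ σ
  cases σ with
  | plus =>
    obtain ⟨-, t, h⟩ := IsCompact.causalSupport htime α.2 .minus
    exact ⟨hs α, t, ht α t h⟩
  | minus =>
    obtain ⟨-, t, h⟩ := IsCompact.causalSupport htime α.2 .plus
    exact ⟨hs α, t, ht α t h⟩

variable [SecondCountableTopology M] [BorelSpace M] [IsLocallyFiniteMeasure μ]

theorem IsGreen.isFluctuation (hG : IsGreen 𝒯 time G) (htime : Continuous time) (B : RegularFunctional 𝒯) (σ : Dir) :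
    IsFluctuation 𝒯 (fun _ => DiffOp.id W) time σ B.toCompactFunctional
      fun φ => ofSmooth μ (G σ.opp φ (B.grad φ)) := by
  refine fun φ hφ => ⟨ofSmooth_isCausal ?_, fun ξ => ?_⟩
  · have := hG.causalSupport htime hφ σ.opp (B.grad φ)
    rwa [Dir.opp_opp] at this
  · rw [ofSmooth_apply, DiffOp.coe_onCompact,
      ← contraction_adjoint_of_right (𝒯.adjoint φ hφ.1) _ ξ.2, (hG φ hφ σ.opp).2.1]
    exact (B.δ_eq φ hφ.1 _).symm

variable [μ.IsOpenPosMeasure]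

/-- Since `J* (G β) = J (G β) = β`, with `G β` supported opposite to `q`, every value of `q` is
given by the fluctuation equation. -/
theorem IsGreen.fluctuation_apply (hG : IsGreen 𝒯 time G) (h𝒯 : 𝒯.IsLagrangian)
    (htime : Continuous time) {q : W.Γ → Distr W.dual}
    (hq : IsFluctuation 𝒯 (fun _ => DiffOp.id W) time σ A q) (hφ : φ ∈ 𝒯.shell)
    (β : Γ₀ W.dual) : q φ β = A.δ φ (G σ φ β) :=
  hq.apply_eq hφ (hG.causalSupport htime hφ σ β)
    (by rw [← h𝒯.J_eq_Jt hφ.1, (hG φ hφ σ).2.1])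

/-- Green functions exclude gauge freedom: all values on test sections are prescribed, so the
fluctuation of given direction is unique. -/
theorem IsGreen.eq_of_isFluctuation (hG : IsGreen 𝒯 time G) (h𝒯 : 𝒯.IsLagrangian)
    (htime : Continuous time) {s s' : W.Γ → W.Γ}
    (hs : IsFluctuation 𝒯 (fun _ => DiffOp.id W) time σ A fun φ => ofSmooth μ (s φ))
    (hs' : IsFluctuation 𝒯 (fun _ => DiffOp.id W) time σ A fun φ => ofSmooth μ (s' φ))
    (hφ : φ ∈ 𝒯.shell) : s φ = s' φ := by
  rw [← sub_eq_zero]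
  refine eq_zero_of_ofSmooth_eq_zero (μ := μ) (LinearMap.ext fun β => ?_)
  rw [ofSmooth_sub, LinearMap.sub_apply, LinearMap.zero_apply, sub_eq_zero,
    hG.fluctuation_apply h𝒯 htime hs hφ, hG.fluctuation_apply h𝒯 htime hs' hφ]

end Green

/-! ### The theorem -/

theorem mainTheorem5 {n : ℕ} {M : Type u} [TopologicalSpace M] [T2Space M]
    [SecondCountableTopology M] [ChartedSpace (EuclideanSpace ℝ (Fin (n + 1))) M]
    [IsManifold (𝓡 (n + 1)) ∞ M] [MeasurableSpace M] [BorelSpace M]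
    {N : Type*} [TopologicalSpace N] [ChartedSpace (EuclideanSpace ℝ (Fin n)) N]
    [IsManifold (𝓡 n) ∞ N]
    (split : Diffeomorph (𝓡 (n + 1)) (𝓘(ℝ, ℝ).prod (𝓡 n)) M (ℝ × N) ∞)
    (time : M → ℝ) (htime : ∀ x, time x = (split x).1)
    (μ : Measure M) [IsLocallyFiniteMeasure μ] (hμ : IsSmoothVolume (n + 1) μ)
    (W D F H : VBundle.{u, v, w} (n + 1) M) :
    (∀ (𝒯 : FieldEquations μ W D) (𝒢 : GaugeGenerators 𝒯 F H)
      (V : W.Γ → DiffOp D W) (Vt : W.Γ → DiffOp W.dual D.dual),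
      IsLagrangeAnchor 𝒯 V Vt → 𝒢.IsAcyclic time →
      ∀ (A : CompactFunctional 𝒯) (B : RegularFunctional 𝒯),
        𝒢.IsObservable A → 𝒢.IsObservable B.toCompactFunctional →
        -- existence of repercussions
        (∀ σ, ∃ ζ, IsRepercussion 𝒯 time σ A ζ) ∧
        (∀ σ, ∃ ξ : W.Γ → D.Γ,
          IsRepercussion 𝒯 time σ B.toCompactFunctional fun φ => ofSmooth μ (ξ φ)) ∧
        -- uniqueness of repercussions modulo `Im L*`
        (∀ σ ζ ζ', IsRepercussion 𝒯 time σ A ζ → IsRepercussion 𝒯 time σ A ζ' →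
          ∀ φ ∈ 𝒯.shell, ∃ m : Distr H.dual, m.IsCausal time σ ∧
            ζ' φ - ζ φ = m ∘ₗ (𝒢.L φ).onCompact) ∧
        (∀ (σ : Dir) (ξ ξ' : W.Γ → D.Γ),
          IsRepercussion 𝒯 time σ B.toCompactFunctional (fun φ => ofSmooth μ (ξ φ)) →
          IsRepercussion 𝒯 time σ B.toCompactFunctional (fun φ => ofSmooth μ (ξ' φ)) →
          ∀ φ ∈ 𝒯.shell, ∃ m : H.Γ, CausalSupport time σ (VBundle.supp m) ∧
            ξ' φ - ξ φ = 𝒢.Lt φ m) ∧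
        -- `A_σ^a V_a` is a fluctuation caused by `A`
        (∀ σ ζ, IsRepercussion 𝒯 time σ A ζ →
          IsFluctuation 𝒯 V time σ A (anchored Vt ζ)) ∧
        (∀ (σ : Dir) (ξ : W.Γ → D.Γ),
          IsRepercussion 𝒯 time σ B.toCompactFunctional (fun φ => ofSmooth μ (ξ φ)) →
          IsFluctuation 𝒯 V time σ B.toCompactFunctional fun φ => ofSmooth μ (V φ (ξ φ))) ∧
        -- for arbitrary fluctuations `V_A^σ = qA σ` and `V_B^σ = sB σ`:
        ∀ (qA : Dir → W.Γ → Distr W.dual) (sB : Dir → W.Γ → W.Γ),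
          (∀ σ, IsFluctuation 𝒯 V time σ A (qA σ)) →
          (∀ σ, IsFluctuation 𝒯 V time σ B.toCompactFunctional fun φ => ofSmooth μ (sB σ φ)) →
          -- reciprocity `V_A^- B ≈ V_B^+ A` and `V_B^- A ≈ V_A^+ B`
          𝒯.OnShellEq (distrAct (qA .minus) B) (smoothAct (sB .plus) A) ∧
          𝒯.OnShellEq (smoothAct (sB .minus) A) (distrAct (qA .plus) B) ∧
          -- the brackets: `{A,B}^+ ≈ {B,A}^-` and `{A,B}^+ ≈ -{A,B}^-`
          𝒯.OnShellEq (bracket A (qA .plus) B (sB .plus)) (bracketOpp A (qA .minus) B (sB .minus)) ∧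
          𝒯.OnShellEq (bracket A (qA .plus) B (sB .plus)) (-bracket A (qA .minus) B (sB .minus)) ∧
          -- `{A,B}^σ ≈ σ (A_+ - A_-)^a V_a B` and `{B,A}^σ ≈ σ (B_+ - B_-)^a V_a A`
          (∀ ζ : Dir → W.Γ → Distr D.dual, (∀ σ, IsRepercussion 𝒯 time σ A (ζ σ)) →
            ∀ σ, 𝒯.OnShellEq (bracket A (qA σ) B (sB σ))
              (σ.sign • distrAct (anchored Vt (ζ .plus - ζ .minus)) B)) ∧
          (∀ ξ : Dir → W.Γ → D.Γ,
            (∀ σ, IsRepercussion 𝒯 time σ B.toCompactFunctional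
              fun φ => ofSmooth μ (ξ σ φ)) →
            ∀ σ, 𝒯.OnShellEq (bracketOpp A (qA σ) B (sB σ))
              (σ.sign • smoothAct (fun φ => V φ (ξ .plus φ - ξ .minus φ)) A))) ∧
    -- Lagrangian equations with the canonical Lagrange anchor `V = 1`
    (∀ 𝒯 : FieldEquations μ W W, 𝒯.IsLagrangian →
      IsLagrangeAnchor 𝒯 (fun _ => DiffOp.id W) (fun _ => DiffOp.id W.dual) ∧
      ∀ G : Dir → W.Γ → Γ₀ W.dual →ₗ[ℝ] W.Γ, IsGreen 𝒯 time G →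
        -- the fluctuations are given by the Green functions
        (∀ (σ : Dir) (A : CompactFunctional 𝒯) (qA : W.Γ → Distr W.dual),
          IsFluctuation 𝒯 (fun _ => DiffOp.id W) time σ A qA →
          ∀ φ ∈ 𝒯.shell, ∀ β : Γ₀ W.dual, qA φ β = A.δ φ (G σ φ β)) ∧
        (∀ (σ : Dir) (B : RegularFunctional 𝒯),
          IsFluctuation 𝒯 (fun _ => DiffOp.id W) time σ B.toCompactFunctional
            fun φ => ofSmooth μ (G σ.opp φ (B.grad φ))) ∧
        -- Peierls' formula `{A,B}^σ ≈ σ A_{,i} (G^{+ij} - G^{-ij}) B_{,j}`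
        ∀ (σ : Dir) (A : CompactFunctional 𝒯) (B : RegularFunctional 𝒯)
          (qA : W.Γ → Distr W.dual) (sB : W.Γ → W.Γ),
          IsFluctuation 𝒯 (fun _ => DiffOp.id W) time σ A qA →
          IsFluctuation 𝒯 (fun _ => DiffOp.id W) time σ B.toCompactFunctional
            (fun φ => ofSmooth μ (sB φ)) →
          𝒯.OnShellEq (bracket A qA B sB)
            (fun φ => σ.sign * A.δ φ (G .plus φ (B.grad φ) - G .minus φ (B.grad φ)))) := by
  have hcont : Continuous time := by
    rw [show time = fun x => (split x).1 from funext htime]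
    exact continuous_fst.comp split.contMDiff_toFun.continuous
  have := hμ.isOpenPosMeasure
  refine ⟨fun 𝒯 𝒢 V Vt hV h𝒢 A B hA hB => ?_, fun 𝒯 h𝒯 => ⟨h𝒯.isLagrangeAnchor_id, fun G hG => ?_⟩⟩
  · refine ⟨hA.exists_isRepercussion h𝒢 hcont, hB.exists_smooth_isRepercussion h𝒢 hcont,
      fun σ ζ ζ' hζ hζ' φ hφ => hζ.exists_sub_eq h𝒢 hζ' hφ,
      fun σ ξ ξ' hξ hξ' φ hφ => hξ.exists_smooth_sub_eq h𝒢 hξ' hφ,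
      fun σ ζ hζ => hζ.isFluctuation_anchored hV,
      fun σ ξ hξ => hξ.isFluctuation_ofSmooth hV, fun qA sB hqA hsB => ?_⟩
    have hr : ∀ (σ : Dir) {q : W.Γ → Distr W.dual} {s : W.Γ → W.Γ},
        IsFluctuation 𝒯 V time σ A q →
        IsFluctuation 𝒯 V time σ.opp B.toCompactFunctional (fun φ => ofSmooth μ (s φ)) →
        ∀ φ ∈ 𝒯.shell, q φ (B.grad φ) = A.δ φ (s φ) :=
      fun σ _ _ hq hs => reciprocity hV h𝒢 hcont hA hB hq hs
    have hmp := hr .minus (hqA .minus) (hsB .plus)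
    have hpm := hr .plus (hqA .plus) (hsB .minus)
    refine ⟨hmp, fun φ hφ => (hpm φ hφ).symm, fun φ hφ => ?_, fun φ hφ => ?_,
      fun ζ hζ σ φ hφ => ?_, fun ξ hξ σ φ hφ => ?_⟩
    · change qA .plus φ (B.grad φ) - A.δ φ (sB .plus φ)
        = A.δ φ (sB .minus φ) - qA .minus φ (B.grad φ)
      rw [hmp φ hφ, hpm φ hφ]
    · change qA .plus φ (B.grad φ) - A.δ φ (sB .plus φ)
        = -(qA .minus φ (B.grad φ) - A.δ φ (sB .minus φ))
      rw [hmp φ hφ, hpm φ hφ, neg_sub]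
    · have hp := hr .plus ((hζ .plus).isFluctuation_anchored hV) (hsB .minus) φ hφ
      have hm := hr .minus ((hζ .minus).isFluctuation_anchored hV) (hsB .plus) φ hφ
      change qA σ φ (B.grad φ) - A.δ φ (sB σ φ)
        = σ.sign * (anchored Vt (ζ .plus) φ (B.grad φ) - anchored Vt (ζ .minus) φ (B.grad φ))
      rw [hp, hm]
      cases σ with
      | plus => rw [hpm φ hφ, Dir.sign, one_mul]
      | minus => rw [hmp φ hφ, Dir.sign, neg_one_mul, neg_sub]
    · have hp := hr .minus (hqA .minus) ((hξ .plus).isFluctuation_ofSmooth hV) φ hφ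
      have hm := hr .plus (hqA .plus) ((hξ .minus).isFluctuation_ofSmooth hV) φ hφ
      change A.δ φ (sB σ φ) - qA σ φ (B.grad φ)
        = σ.sign * A.δ φ (V φ (ξ .plus φ - ξ .minus φ))
      rw [map_sub, map_sub, ← hp, ← hm]
      cases σ with
      | plus => rw [hmp φ hφ, Dir.sign, one_mul]
      | minus => rw [hpm φ hφ, Dir.sign, neg_one_mul, neg_sub]
  · refine ⟨fun σ A qA hqA φ hφ β => hG.fluctuation_apply h𝒯 hcont hqA hφ β,
      fun σ B => hG.isFluctuation hcont B σ, fun σ A B qA sB hqA hsB φ hφ => ?_⟩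
    change qA φ (B.grad φ) - A.δ φ (sB φ)
      = σ.sign * A.δ φ (G .plus φ (B.grad φ) - G .minus φ (B.grad φ))
    -- Uniqueness replaces the arbitrary `sB` by the Green function with label `σ.opp`, so the two
    -- terms of the bracket contain `G^σ` and the opposite Green function.
    rw [hG.fluctuation_apply h𝒯 hcont hqA hφ,
      hG.eq_of_isFluctuation h𝒯 hcont hsB (hG.isFluctuation hcont B σ) hφ, map_sub]
    cases σ with
    | plus => rw [Dir.sign, one_mul, Dir.opp]
    | minus => rw [Dir.sign, neg_one_mul, neg_sub, Dir.opp]
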